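/- Let $S$ be a left cancellative monoid with identity $e$. Let $I_\ell(S)$ be the inverse semigroup of partial bijections of $S$ generated by the left translations, and $\mathcal J(S)$ the collection of constructible right ideals $X=s_1^{-1}t_1\cdots s_n^{-1}t_nS$; the idempotents of $I_\ell(S)$ are exactly the identity maps $p_X$ of the sets $X\in\mathcal J(S)$. Let $\mathcal G(I_\ell(S))$ be the Paterson groupoid of germs $[g,\chi]$, where $g\in I_\ell(S)$ and $\chi$ is a semi-character (a multiplicative, not identically zero, $\{0,1\}$-valued map) on the semilattice $E(S)$ of idempotents of $I_\ell(S)$ with $\chi(g^{-1}g)=1$, and where $[g,\chi]=[h,\chi]$ iff $gp=hp$ for some $p\in E(S)$ with $\chi(p)=1$; its topology has as a basis the sets $\{[g,\chi]:\chi\in U\}$ with $U$ open in $\{\chi:\chi(g^{-1}g)=1\}$. For $s\in S$ let $\chi_s(p_X)=\mathbf 1_X(s)$, let $\Omega(S)$ be the closure of $\{\chi_s : s\in S\}$ in the topology of pointwise convergence (the closure of the orbit of $\chi_e$), and let $\mathcal G_P(S)$ be the reduction of $\mathcal G(I_\ell(S))$ to $\Omega(S)$. Let $\mathcal G(S)=\mathcal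 G_P(S)/{\sim}$ be the quotient groupoid, where $[g,\chi]\sim[h,\chi]$ iff there are $X,X_1,\dots,X_m\in\mathcal J(S)$, $m\ge 0$, with $\chi(p_X)=1$, $\chi(p_{X_i})=0$ for all $i$, and $g=h$ on $X\setminus\bigcup_i X_i$. Let $C^*_r(\mathcal G_P(S))$ be the reduced groupoid C$^*$-algebra, that is, the completion of $C_c(\mathcal G_P(S))$ in the norm $\|f\|_r=\sup_x\|\rho_x(f)\|$, where $(\rho_x(f)\xi)(g)=\sum_{r(h)=r(g)}f(h)\xi(h^{-1}g)$ on $\ell^2(s^{-1}(x))$. Let $C^*_r(S)\subset B(\ell^2(S))$ be the C$^*$-algebra generated by the operators $\lambda_s\delta_t=\delta_{st}$, $s\in S$. View $\rho_{\chi_e}$ as a representation on $\ell^2(S)$ through the bijection $S\to s^{-1}(\chi_e)$, $s\mapsto[s,\chi_e]$. 1. If $\rho_{\chi_e}$ defines an isomorphism $C^*_r(\mathcal G_P(S))\cong C^*_r(S)$, then $\mathcal G_P(S)=\mathcal G(S)$; that is, the quotient map $\mathcal G_P(S)\to\mathcal G(S)$ is an isomorphism of topological groupoids. 2. In particular, $\mathcal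 G_P(S)=\mathcal G(S)$ in the same sense whenever $S$ is strongly C$^*$-regular, that is, whenever the following holds: for all $h_1,\dots,h_n\in I_\ell(S)$ and $X,X_1,\dots,X_m\in\mathcal J(S)$ ($m\ge0$) with $\emptyset\ne X\setminus\bigcup_iX_i\subset\bigcup_k\{s\in S:h_ks=s\}$ there are $Y_1,\dots,Y_l\in\mathcal J(S)$ and indices $k_1,\dots,k_l\in\{1,\dots,n\}$ with $X\setminus\bigcup_iX_i\subset\bigcup_jY_j$ and $h_{k_j}p_{Y_j}=p_{Y_j}$ for all $j$. -/

import Mathlib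

open scoped ENNReal

universe u v

/-! ### Groupoids, their convolution functions and their reduced C*-algebras -/

/-- A groupoid with set of arrows `G` and set of objects `X`. The product `mul a b h` is defined
when the source of `a` is the range of `b`, and `unit` embeds the objects into the arrows. -/
class Grpd (X : outParam (Type u)) (G : Type v) where
  src : G → X
  rng : G → X
  unit : X → G
  inv : G → G
  mul : (a b : G) → src a = rng b → G
  src_unit : ∀ x, src (unit x) = x
  rng_unit : ∀ x, rng (unit x) = x
  src_inv : ∀ a, src (inv a) = rng a
  rng_inv : ∀ a, rng (inv a) = src a
  src_mul : ∀ a b h, src (mul a b h) = src b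
  rng_mul : ∀ a b h, rng (mul a b h) = rng a
  mul_assoc : ∀ a b c (h : src a = rng b) (h' : src b = rng c),
    mul (mul a b h) c ((src_mul a b h).trans h') =
      mul a (mul b c h') (h.trans (rng_mul b c h').symm)
  mul_unit : ∀ a, mul a (unit (src a)) (rng_unit _).symm = a
  unit_mul : ∀ a, mul (unit (rng a)) a (src_unit _) = a
  inv_mul : ∀ a, mul (inv a) a (src_inv a) = unit (src a)
  mul_inv : ∀ a, mul a (inv a) (rng_inv a).symm = unit (rng a)

namespace Grpd

/-- The reduction of a groupoid to an invariant set `Ω` of objects. -/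
@[reducible]
def reduction {X : Type u} {G : Type v} [Grpd X G] (Ω : Set X)
    (hΩ : ∀ a : G, src a ∈ Ω → rng a ∈ Ω) : Grpd Ω {a : G // src a ∈ Ω} where
  src a := ⟨src a.1, a.2⟩
  rng a := ⟨rng a.1, hΩ _ a.2⟩
  unit x := ⟨unit x.1, by rw [src_unit]; exact x.2⟩
  inv a := ⟨inv a.1, by rw [src_inv]; exact hΩ _ a.2⟩
  mul a b h := ⟨mul a.1 b.1 (congrArg Subtype.val h), by rw [src_mul]; exact b.2⟩
  src_unit x := Subtype.ext (src_unit _)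
  rng_unit x := Subtype.ext (rng_unit _)
  src_inv a := Subtype.ext (src_inv _)
  rng_inv a := Subtype.ext (rng_inv _)
  src_mul a b h := Subtype.ext (src_mul _ _ _)
  rng_mul a b h := Subtype.ext (rng_mul _ _ _)
  mul_assoc a b c h h' := Subtype.ext (mul_assoc _ _ _ _ _)
  mul_unit a := Subtype.ext (mul_unit _)
  unit_mul a := Subtype.ext (unit_mul _)
  inv_mul a := Subtype.ext (inv_mul _)
  mul_inv a := Subtype.ext (mul_inv _)

/-- A map between topological groupoids with the same objects is an isomorphism of topological
groupoids (over the identity on objects). -/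
structure IsTopIso {X : Type u} {G H : Type v} [Grpd X G] [Grpd X H] [TopologicalSpace G]
    [TopologicalSpace H] (φ : G → H) : Prop where
  isHomeomorph : IsHomeomorph φ
  src_map : ∀ a, src (φ a) = src a
  rng_map : ∀ a, rng (φ a) = rng a
  unit_map : ∀ x, φ (unit x) = unit x
  inv_map : ∀ a, φ (inv a) = inv (φ a)
  mul_map : ∀ a b (h : src a = rng b),
    φ (mul a b h) = mul (φ a) (φ b) (by rw [src_map, rng_map, h])

end Grpd

/-- The Hilbert space `ℓ²(ι)`. -/
abbrev EllTwo (ι : Type u) : Type u := lp (fun _ : ι => ℂ) 2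

/-- The space `C_c(G)` of a possibly non-Hausdorff space: the linear span of the continuous
compactly supported functions on the open Hausdorff subsets `V`, extended by zero to `G`. -/
def CcSpan (G : Type v) [TopologicalSpace G] : Submodule ℂ (G → ℂ) :=
  Submodule.span ℂ {f | ∃ V : Set G, IsOpen V ∧ T2Space V ∧ ContinuousOn f V ∧
    ∃ K : Set G, K ⊆ V ∧ IsCompact K ∧ ∀ g, g ∉ K → f g = 0}

section reduced

variable {X : Type u} (G : Type v) [Grpd X G]

/-- `G_x = s⁻¹(x)`. -/
abbrev SrcFiber (x : X) : Type v := {g : G // Grpd.src g = x}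

variable {G}

/-- `h⁻¹g ∈ G_x` for `g ∈ G_x` and `h` with `r(h) = r(g)`. -/
def SrcFiber.invMul {x : X} (g : SrcFiber G x) (h : G) (hh : Grpd.rng h = Grpd.rng g.1) :
    SrcFiber G x :=
  ⟨Grpd.mul (Grpd.inv h) g.1 ((Grpd.src_inv h).trans hh), (Grpd.src_mul _ _ _).trans g.2⟩

/-- The bounded operator `T` on `ℓ²(G_x)` is `ρ_x(f)`, that is,
`(T ξ)(g) = ∑_{h ∈ G^{r(g)}} f(h) ξ(h⁻¹g)`. -/
def IsRho (x : X) (f : G → ℂ) (T : EllTwo (SrcFiber G x) →L[ℂ] EllTwo (SrcFiber G x)) : Prop :=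
  ∀ (ξ : EllTwo (SrcFiber G x)) (g : SrcFiber G x),
    T ξ g = ∑' h : {h : G // Grpd.rng h = Grpd.rng g.1}, f h.1 * ξ (g.invMul h.1 h.2)

variable (G)

/-- The C*-algebra of bounded families `(T_x)_x` of bounded operators on the spaces `ℓ²(G_x)`, with
the pointwise operations and the norm `sup_x ‖T_x‖`. -/
def FiberOps : Type (max u v) :=
  lp (fun x : X => EllTwo (SrcFiber G x) →L[ℂ] EllTwo (SrcFiber G x)) ∞

noncomputable instance : NonUnitalCStarAlgebra (FiberOps G) :=
  inferInstanceAs (NonUnitalCStarAlgebra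
    (lp (fun x : X => EllTwo (SrcFiber G x) →L[ℂ] EllTwo (SrcFiber G x)) ∞))

/-- The reduced C*-algebra of an étale groupoid. The reduced norm of `f ∈ C_c(G)` is
`sup_x ‖ρ_x(f)‖`, so the completion is the closure of the image of `C_c(G)` under the
`*`-homomorphism `f ↦ (ρ_x(f))_x`. (For an étale groupoid every `f ∈ C_c(G)` acts by a bounded
family of bounded operators, and the image of `C_c(G)` is a `*`-subalgebra, so that passing to the
generated `*`-subalgebra adds nothing.) -/
noncomputable def reducedCStar [TopologicalSpace G] : NonUnitalStarSubalgebra ℂ (FiberOps G) :=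
  (NonUnitalStarAlgebra.adjoin ℂ
    {a : FiberOps G | ∃ f ∈ CcSpan G, ∀ x : X, IsRho x f (a.1 x)}).topologicalClosure

/-- The representation `ρ_x` of the reduced C*-algebra on `ℓ²(G_x)`. -/
noncomputable def rho [TopologicalSpace G] (x : X) :
    reducedCStar G →⋆ₙₐ[ℂ] (EllTwo (SrcFiber G x) →L[ℂ] EllTwo (SrcFiber G x)) where
  toFun a := a.1.1 x
  map_smul' _ _ := rfl
  map_zero' := rfl
  map_add' _ _ := rfl
  map_mul' _ _ := rfl
  map_star' _ := rfl

end reduced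

/-! ### The left inverse hull and the constructible ideals -/

section hull

variable (S : Type u) [LeftCancelMonoid S]

open Classical in
/-- The left translation `t ↦ s * t`, as a partial bijection of `S` with domain `S`. -/
noncomputable def leftTranslation {S : Type u} [LeftCancelMonoid S] (s : S) : S ≃. S where
  toFun t := some (s * t)
  invFun t := if h : ∃ x, s * x = t then some h.choose else none
  inv a b := by
    constructor
    · intro h
      split_ifs at h with hx
      have := hx.choose_spec
      simp only [Option.some.injEq] at h
      rw [h] at this
      rw [this]
    · intro h
      simp only [Option.some.injEq] at h
      have hx : ∃ x, s * x = b := ⟨a, h⟩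
      rw [dif_pos hx]
      exact congrArg some (mul_left_cancel (hx.choose_spec.trans h.symm))

/-- The partial bijections in the inverse semigroup generated by the left translations
(`f.trans g` is "first `f`, then `g`"). -/
inductive MemInvHull {S : Type u} [LeftCancelMonoid S] : (S ≃. S) → Prop
  | left (s : S) : MemInvHull (leftTranslation s)
  | symm (g : S ≃. S) : MemInvHull g → MemInvHull g.symm
  | trans (g h : S ≃. S) : MemInvHull g → MemInvHull h → MemInvHull (g.trans h)

/-- The left inverse hull `I_ℓ(S)`. -/
def InvHull : Type u := {g : S ≃. S // MemInvHull g}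

/-- The constructible right ideals `s₁⁻¹ t₁ ⋯ sₙ⁻¹ tₙ S`, where `s⁻¹` denotes the preimage
under left translation by `s`. -/
inductive IsConstructible : Set S → Prop
  | univ : IsConstructible Set.univ
  | step (s t : S) (X : Set S) :
      IsConstructible X → IsConstructible ((fun x => s * x) ⁻¹' ((fun x => t * x) '' X))

/-- The collection `𝒥(S)` of constructible right ideals. -/
def ConstrIdeal : Type u := {X : Set S // IsConstructible S X}

variable {S}

namespace InvHull

/-- The inverse in `I_ℓ(S)`. -/
def inv (g : InvHull S) : InvHull S := ⟨g.1.symm, .symm _ g.2⟩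

/-- The product `gh` in `I_ℓ(S)`: first `h`, then `g`. -/
def mul (g h : InvHull S) : InvHull S := ⟨h.1.trans g.1, .trans _ _ h.2 g.2⟩

/-- The element of `I_ℓ(S)` given by `s ∈ S`. -/
noncomputable def ofElem (s : S) : InvHull S := ⟨leftTranslation s, .left s⟩

/-- The domain of definition of `g`. -/
def domSet (g : InvHull S) : Set S := {s | (g.1 s).isSome}

/-- The preimage `g⁻¹(A) = {s ∈ dom g | gs ∈ A}`. -/
def preSet (g : InvHull S) (A : Set S) : Set S := {s | ∃ t ∈ A, g.1 s = some t}

end InvHull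

theorem leftTranslation_apply (s t : S) : leftTranslation s t = some (s * t) := rfl

theorem leftTranslation_one : leftTranslation (1 : S) = PEquiv.refl S := by
  ext x y; simp [leftTranslation_apply]

theorem leftTranslation_symm_eq (s a b : S) :
    (leftTranslation s).symm a = some b ↔ s * b = a := by
  rw [PEquiv.eq_some_iff, leftTranslation_apply, Option.some.injEq]

theorem IsConstructible.pre_both {g : S ≃. S} (hg : MemInvHull g) :
    ∀ X, IsConstructible S X → IsConstructible S {s | ∃ t ∈ X, g s = some t} ∧
      IsConstructible S {s | ∃ t ∈ X, g.symm s = some t} := by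
  induction hg with
  | left s =>
    intro X hX
    constructor
    · have := IsConstructible.step s 1 X hX
      convert this using 1
      ext x
      simp [leftTranslation_apply]
    · have := IsConstructible.step 1 s X hX
      convert this using 1
      ext x
      simp [leftTranslation_symm_eq]
  | symm g _ ih => exact fun X hX => ⟨(ih X hX).2, (ih X hX).1⟩
  | trans g h _ _ ihg ihh =>
    intro X hX
    constructor
    · convert (ihg _ (ihh X hX).1).1 using 1
      ext x
      simp only [Set.mem_ofPred_eq, PEquiv.trans_eq_some]
      constructor
      · rintro ⟨t, ht, b, hb, hb'⟩; exact ⟨b, ⟨t, ht, hb'⟩, hb⟩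
      · rintro ⟨b, ⟨t, ht, hb'⟩, hb⟩; exact ⟨t, ht, b, hb, hb'⟩
    · convert (ihh _ (ihg X hX).2).2 using 1
      ext x
      simp only [Set.mem_ofPred_eq, PEquiv.symm_trans_rev, PEquiv.trans_eq_some]
      constructor
      · rintro ⟨t, ht, b, hb, hb'⟩; exact ⟨b, ⟨t, ht, hb'⟩, hb⟩
      · rintro ⟨b, ⟨t, ht, hb'⟩, hb⟩; exact ⟨t, ht, b, hb, hb'⟩

theorem InvHull.isConstructible_preSet (g : InvHull S) {X : Set S} (hX : IsConstructible S X) :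
    IsConstructible S (g.preSet X) := (IsConstructible.pre_both g.2 X hX).1

theorem InvHull.preSet_univ (g : InvHull S) : g.preSet Set.univ = g.domSet := by
  ext s; simp [preSet, domSet, Option.isSome_iff_exists]

theorem InvHull.isConstructible_domSet (g : InvHull S) : IsConstructible S g.domSet := by
  rw [← g.preSet_univ]; exact g.isConstructible_preSet .univ

theorem IsConstructible.exists_domSet {X : Set S} (hX : IsConstructible S X) :
    ∃ g : InvHull S, g.domSet = X := by
  induction hX with
  | univ => exact ⟨InvHull.ofElem 1, by ext; simp [InvHull.domSet, InvHull.ofElem,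
      leftTranslation_apply]⟩
  | step s t X _ ih =>
    obtain ⟨g, rfl⟩ := ih
    refine ⟨g.mul ((InvHull.ofElem t).inv.mul (InvHull.ofElem s)), ?_⟩
    ext x
    simp only [InvHull.domSet, InvHull.mul, InvHull.inv, InvHull.ofElem, Set.mem_ofPred_eq,
      Option.isSome_iff_exists, PEquiv.trans_eq_some, leftTranslation_apply, Option.some.injEq,
      leftTranslation_symm_eq, Set.mem_preimage, Set.mem_image]
    constructor
    · rintro ⟨a, b, ⟨c, rfl, h⟩, hb⟩; exact ⟨b, ⟨a, hb⟩, h⟩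
    · rintro ⟨b, ⟨a, hb⟩, h⟩; exact ⟨a, b, ⟨_, rfl, h⟩, hb⟩

open Classical in
/-- `E(S) ≅ 𝒥(S)`: the idempotents of `I_ℓ(S)` are exactly the identity maps `p_X` of the
constructible ideals `X`. -/
theorem InvHull.idempotent_iff (p : S ≃. S) :
    (MemInvHull p ∧ p.trans p = p) ↔ ∃ X, IsConstructible S X ∧ p = PEquiv.ofSet X := by
  constructor
  · rintro ⟨hp, hpp⟩
    refine ⟨_, InvHull.isConstructible_domSet ⟨p, hp⟩, ?_⟩
    ext x y
    have key : ∀ z, p x = some z → x = z := by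
      intro z hz
      have h2 : (p.trans p) x = some z := by rw [hpp, hz]
      rw [PEquiv.trans_eq_some] at h2
      obtain ⟨b, hb, hb'⟩ := h2
      rw [hz, Option.some.injEq] at hb
      subst hb
      exact p.inj hz hb'
    simp only [PEquiv.ofSet_eq_some_iff, InvHull.domSet, Set.mem_ofPred_eq,
      Option.isSome_iff_exists]
    constructor
    · intro h
      have := key y h
      subst this
      exact ⟨rfl, _, h⟩
    · rintro ⟨rfl, z, hz⟩
      have := key z hz
      subst this
      exact hz
  · rintro ⟨X, hX, rfl⟩
    obtain ⟨g, rfl⟩ := hX.exists_domSet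
    constructor
    · have := MemInvHull.trans _ _ g.2 (.symm _ g.2)
      rw [PEquiv.self_trans_symm] at this
      have hd : g.domSet = {a | (g.1 a).isSome} := rfl
      rw! [hd]
      convert this
    · ext x y
      rw [PEquiv.trans_eq_some]
      simp only [PEquiv.ofSet_eq_some_iff]
      constructor
      · rintro ⟨b, ⟨rfl, h⟩, ⟨rfl, _⟩⟩; exact ⟨rfl, h⟩
      · rintro ⟨rfl, h⟩; exact ⟨_, ⟨rfl, h⟩, ⟨rfl, h⟩⟩

theorem IsConstructible.inter {X Y : Set S} (hX : IsConstructible S X)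
    (hY : IsConstructible S Y) : IsConstructible S (X ∩ Y) := by
  classical
  have h := ((InvHull.idempotent_iff (PEquiv.ofSet X)).2 ⟨X, hX, rfl⟩).1
  convert (IsConstructible.pre_both h Y hY).1 using 1
  ext s
  simp only [PEquiv.ofSet_eq_some_iff, Set.mem_inter_iff, Set.mem_ofPred_eq]
  constructor
  · rintro ⟨h1, h2⟩; exact ⟨s, h2, rfl, h1⟩
  · rintro ⟨t, h1, rfl, h2⟩; exact ⟨h2, h1⟩

namespace ConstrIdeal

/-- The semigroup operation of `𝒥(S)`. -/
def inter (X Y : ConstrIdeal S) : ConstrIdeal S := ⟨X.1 ∩ Y.1, X.2.inter Y.2⟩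

/-- The ideal `S`. -/
def univ : ConstrIdeal S := ⟨Set.univ, .univ⟩

end ConstrIdeal

/-- The domain of `g`, a constructible ideal; `p_{dom g} = g⁻¹g`. -/
def InvHull.dom (g : InvHull S) : ConstrIdeal S := ⟨g.domSet, g.isConstructible_domSet⟩

/-- The constructible ideal `g⁻¹(X)`; `p_{g⁻¹(X)} = g⁻¹ p_X g`. -/
def InvHull.pre (g : InvHull S) (X : ConstrIdeal S) : ConstrIdeal S :=
  ⟨g.preSet X.1, g.isConstructible_preSet X.2⟩

variable (S) in
/-- Semi-characters of `E(S) ≅ 𝒥(S)`: multiplicative maps to `{0,1}` that are not identically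
zero. We write `χ X` for `χ(p_X)`. The topology is that of pointwise convergence. -/
abbrev SemiChar : Type u :=
  {χ : ConstrIdeal S → Bool // (∀ X Y, χ (X.inter Y) = (χ X && χ Y)) ∧ ∃ X, χ X = true}

namespace SemiChar

theorem inter_eq_true (χ : SemiChar S) (X Y : ConstrIdeal S) :
    χ.1 (X.inter Y) = true ↔ χ.1 X = true ∧ χ.1 Y = true := by
  rw [χ.2.1, Bool.and_eq_true]

theorem mono (χ : SemiChar S) {X Y : ConstrIdeal S} (h : X.1 ⊆ Y.1) (hX : χ.1 X = true) :
    χ.1 Y = true := by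
  have : X.inter Y = X := Subtype.ext (Set.inter_eq_left.2 h)
  rw [← this, inter_eq_true] at hX
  exact hX.2

theorem univ_eq (χ : SemiChar S) : χ.1 ConstrIdeal.univ = true :=
  let ⟨_, hX⟩ := χ.2.2
  χ.mono (Set.subset_univ _) hX

theorem dom_mul (g h : InvHull S) : (g.mul h).dom = h.pre g.dom := by
  apply Subtype.ext
  ext s
  simp only [InvHull.dom, InvHull.pre, InvHull.mul, InvHull.domSet, InvHull.preSet,
    Set.mem_ofPred_eq, Option.isSome_iff_exists, PEquiv.trans_eq_some]
  constructor
  · rintro ⟨a, b, h1, h2⟩; exact ⟨b, ⟨a, h2⟩, h1⟩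
  · rintro ⟨b, ⟨a, h2⟩, h1⟩; exact ⟨a, b, h1, h2⟩

/-- The semi-character `χ(g⁻¹ · g)`, for `χ(g⁻¹g) = 1`. -/
def act (g : InvHull S) (χ : SemiChar S) (h : χ.1 g.dom = true) : SemiChar S :=
  ⟨fun X => χ.1 (g.pre X), fun X Y => by
    rw [← χ.2.1]
    refine congrArg χ.1 ?_
    apply Subtype.ext
    ext s
    simp only [InvHull.pre, InvHull.preSet, ConstrIdeal.inter, Set.mem_inter_iff, Set.mem_ofPred_eq]
    constructor
    · rintro ⟨t, ⟨h1, h2⟩, h3⟩; exact ⟨⟨t, h1, h3⟩, ⟨t, h2, h3⟩⟩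
    · rintro ⟨⟨t, h1, h3⟩, ⟨t', h2, h4⟩⟩
      rw [h3, Option.some.injEq] at h4
      subst h4
      exact ⟨t, ⟨h1, h2⟩, h3⟩,
    ConstrIdeal.univ, by
      have : g.pre ConstrIdeal.univ = g.dom := Subtype.ext g.preSet_univ
      exact (congrArg χ.1 this).trans h⟩

open Classical in
/-- The semi-character `χ_s(p_X) = 1_X(s)`. -/
noncomputable def point (s : S) : SemiChar S :=
  ⟨fun X => decide (s ∈ X.1), fun X Y => by simp [ConstrIdeal.inter], ConstrIdeal.univ,
    by simp [ConstrIdeal.univ]⟩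

theorem point_eq_true (s : S) (X : ConstrIdeal S) : (point s).1 X = true ↔ s ∈ X.1 := by
  simp [point]

end SemiChar

end hull

/-! ### The groupoid of the left inverse hull and its reduction -/

section paterson

variable {S : Type u} [LeftCancelMonoid S]

namespace InvHull

theorem preSet_mul (g h : InvHull S) (A : Set S) : (g.mul h).preSet A = h.preSet (g.preSet A) := by
  ext s
  simp only [mul, preSet, Set.mem_ofPred_eq, PEquiv.trans_eq_some]
  constructor
  · rintro ⟨a, ha, b, h1, h2⟩; exact ⟨b, ⟨a, ha, h2⟩, h1⟩
  · rintro ⟨b, ⟨a, ha, h2⟩, h1⟩; exact ⟨a, ha, b, h1, h2⟩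

theorem pre_mul (g h : InvHull S) (X : ConstrIdeal S) : (g.mul h).pre X = h.pre (g.pre X) :=
  Subtype.ext (preSet_mul g h X.1)

theorem preSet_inv_preSet (g : InvHull S) (A : Set S) :
    g.preSet (g.inv.preSet A) = g.domSet ∩ A := by
  ext s
  simp only [inv, preSet, domSet, Set.mem_inter_iff, Set.mem_ofPred_eq, PEquiv.eq_some_iff,
    Option.isSome_iff_exists]
  constructor
  · rintro ⟨t, ⟨r, hr, h1⟩, h2⟩
    have := g.1.inj h1 h2
    subst this
    exact ⟨⟨t, h2⟩, hr⟩
  · rintro ⟨⟨t, h2⟩, hs⟩; exact ⟨t, ⟨s, hs, h2⟩, h2⟩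

/-- The identity element of `I_ℓ(S)`. -/
noncomputable def one : InvHull S := ofElem 1

theorem one_val : (one : InvHull S).1 = PEquiv.refl S := leftTranslation_one

theorem preSet_one (A : Set S) : (one : InvHull S).preSet A = A := by
  ext s; simp [preSet, one_val]

theorem ofElem_dom (s : S) : (ofElem s).dom = ConstrIdeal.univ := by
  apply Subtype.ext
  ext t
  simp [dom, ConstrIdeal.univ, domSet, ofElem, leftTranslation_apply]

end InvHull

namespace SemiChar

theorem pre_inv_eq (χ : SemiChar S) (g : InvHull S) (h : χ.1 g.dom = true) (X : ConstrIdeal S) :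
    χ.1 (g.pre (g.inv.pre X)) = χ.1 X := by
  have : g.pre (g.inv.pre X) = g.dom.inter X := Subtype.ext (g.preSet_inv_preSet X.1)
  rw [this, χ.2.1, h, Bool.true_and]

theorem act_inv_dom (χ : SemiChar S) (g : InvHull S) (h : χ.1 g.dom = true) :
    (act g χ h).1 g.inv.dom = true := by
  have h1 := χ.pre_inv_eq g h ConstrIdeal.univ
  have h2 : g.inv.pre ConstrIdeal.univ = g.inv.dom := Subtype.ext g.inv.preSet_univ
  rw [h2, χ.univ_eq] at h1
  exact h1

theorem act_inv_act (χ : SemiChar S) (g : InvHull S) (h : χ.1 g.dom = true) :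
    act g.inv (act g χ h) (χ.act_inv_dom g h) = χ :=
  Subtype.ext (funext fun X => χ.pre_inv_eq g h X)

theorem act_one (χ : SemiChar S) (h : χ.1 InvHull.one.dom = true) :
    act InvHull.one χ h = χ :=
  Subtype.ext (funext fun X => congrArg χ.1 (Subtype.ext (InvHull.preSet_one X.1)))

theorem mul_dom (χ : SemiChar S) (g h : InvHull S) (hh : χ.1 h.dom = true)
    (hg : (act h χ hh).1 g.dom = true) : χ.1 (g.mul h).dom = true := by
  rw [dom_mul]; exact hg

theorem act_mul (χ : SemiChar S) (g h : InvHull S) (hh : χ.1 h.dom = true)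
    (hg : (act h χ hh).1 g.dom = true) :
    act (g.mul h) χ (χ.mul_dom g h hh hg) = act g (act h χ hh) hg :=
  Subtype.ext (funext fun X => congrArg χ.1 (InvHull.pre_mul g h X))

/-- `A` is a constructible ideal with `χ(p_A) = 1`. -/
def Holds (χ : SemiChar S) (A : Set S) : Prop := ∃ X : ConstrIdeal S, A = X.1 ∧ χ.1 X = true

/-- `A` has the form `X \ (X₁ ∪ ⋯ ∪ X_m)` for constructible ideals `X, X₁, …, X_m` (`m ≥ 0`) such
that `χ(p_X) = 1` and `χ(p_{X_i}) = 0` for all `i`; that is, the extension of `χ` to the sets of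
this form takes the value `1` at `A`. -/
def HoldsExt (χ : SemiChar S) (A : Set S) : Prop :=
  ∃ (X : ConstrIdeal S) (F : Finset (ConstrIdeal S)), A = X.1 \ ⋃ Y ∈ F, Y.1 ∧
    χ.1 X = true ∧ ∀ Y ∈ F, χ.1 Y = false

/-- Auxiliary: properties shared by `Holds` and `HoldsExt`. -/
structure GermSys (N : SemiChar S → Set S → Prop) : Prop where
  ideal : ∀ χ (X : ConstrIdeal S), χ.1 X = true → N χ X.1
  inter : ∀ χ A B, N χ A → N χ B → N χ (A ∩ B)
  pre : ∀ χ (g : InvHull S) (h : χ.1 g.dom = true) A, N (act g χ h) A → N χ (g.preSet A)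

theorem germSys_holds : GermSys (Holds (S := S)) where
  ideal _ X h := ⟨X, rfl, h⟩
  inter := by
    rintro χ _ _ ⟨X, rfl, hX⟩ ⟨Y, rfl, hY⟩
    exact ⟨X.inter Y, rfl, (χ.inter_eq_true X Y).2 ⟨hX, hY⟩⟩
  pre := by
    rintro χ g h _ ⟨X, rfl, hX⟩
    exact ⟨g.pre X, rfl, hX⟩

theorem germSys_holdsExt : GermSys (HoldsExt (S := S)) where
  ideal _ X h := ⟨X, ∅, by simp, h, by simp⟩
  inter := by
    classical
    rintro χ _ _ ⟨X, F, rfl, hX, hF⟩ ⟨Y, F', rfl, hY, hF'⟩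
    refine ⟨X.inter Y, F ∪ F', ?_, (χ.inter_eq_true X Y).2 ⟨hX, hY⟩, ?_⟩
    · ext s
      simp only [ConstrIdeal.inter, Set.mem_inter_iff, Set.mem_sdiff, Set.mem_iUnion,
        Finset.mem_union]
      grind
    · intro Z hZ
      rcases Finset.mem_union.1 hZ with h | h
      exacts [hF Z h, hF' Z h]
  pre := by
    classical
    rintro χ g h _ ⟨X, F, rfl, hX, hF⟩
    refine ⟨g.pre X, F.image g.pre, ?_, hX, ?_⟩
    · ext s
      simp only [InvHull.preSet, InvHull.pre, Set.mem_sdiff, Set.mem_iUnion, Set.mem_ofPred_eq,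
        Finset.mem_image, exists_prop]
      constructor
      · rintro ⟨t, ⟨ht, hn⟩, hs⟩
        refine ⟨⟨t, ht, hs⟩, ?_⟩
        rintro ⟨_, ⟨Y, hY, rfl⟩, t', ht', hs'⟩
        rw [hs, Option.some.injEq] at hs'
        subst hs'
        exact hn ⟨Y, hY, ht'⟩
      · rintro ⟨⟨t, ht, hs⟩, hn⟩
        refine ⟨t, ⟨ht, ?_⟩, hs⟩
        rintro ⟨Y, hY, htY⟩
        exact hn ⟨_, ⟨Y, hY, rfl⟩, t, htY, hs⟩
    · intro Z hZ
      obtain ⟨Y, hY, rfl⟩ := Finset.mem_image.1 hZ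
      exact hF Y hY

/-- Auxiliary: `g` and `h` agree on a set belonging to `N χ`. -/
def GermEq (N : SemiChar S → Set S → Prop) (χ : SemiChar S) (g h : InvHull S) : Prop :=
  ∃ A, N χ A ∧ Set.EqOn g.1 h.1 A

namespace GermSys

variable {N : SemiChar S → Set S → Prop}

theorem refl (hN : GermSys N) (χ : SemiChar S) (g : InvHull S) : GermEq N χ g g :=
  ⟨_, hN.ideal χ ConstrIdeal.univ χ.univ_eq, fun _ _ => rfl⟩

theorem trans (hN : GermSys N) {χ : SemiChar S} {g h k : InvHull S} (h1 : GermEq N χ g h) (h2 : GermEq N χ h k) :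
    GermEq N χ g k := by
  obtain ⟨A, hA, e⟩ := h1
  obtain ⟨B, hB, e'⟩ := h2
  exact ⟨_, hN.inter χ A B hA hB, fun s hs => (e hs.1).trans (e' hs.2)⟩

theorem mul (hN : GermSys N) {ψ : SemiChar S} {g g' h h' : InvHull S} (hh : ψ.1 h.dom = true)
    (h1 : GermEq N (act h ψ hh) g g') (h2 : GermEq N ψ h h') :
    GermEq N ψ (g.mul h) (g'.mul h') := by
  obtain ⟨A, hA, e⟩ := h1
  obtain ⟨B, hB, e'⟩ := h2
  refine ⟨_, hN.inter ψ _ _ (hN.pre ψ h hh A hA) hB, ?_⟩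
  rintro s ⟨⟨t, ht, hs⟩, hsB⟩
  have hs' : h'.1 s = some t := by rw [← e' hsB, hs]
  change (h.1 s).bind g.1 = (h'.1 s).bind g'.1
  rw [hs, hs']
  exact e ht

theorem inv (hN : GermSys N) {χ : SemiChar S} {g h : InvHull S} (hg : χ.1 g.dom = true)
    (h1 : GermEq N χ g h) : GermEq N (act g χ hg) g.inv h.inv := by
  obtain ⟨A, hA, e⟩ := h1
  refine ⟨g.inv.preSet A, hN.pre _ _ (χ.act_inv_dom g hg) A ?_, ?_⟩
  · rw [χ.act_inv_act g hg]; exact hA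
  · rintro t ⟨a, ha, h2⟩
    have h3 : g.1 a = some t := (PEquiv.eq_some_iff g.1).1 h2
    have h4 : h.1 a = some t := by rw [← e ha, h3]
    exact h2.trans ((PEquiv.eq_some_iff h.1).2 h4).symm

end GermSys

theorem GermEq.symm {N : SemiChar S → Set S → Prop} {χ : SemiChar S} {g h : InvHull S}
    (h1 : GermEq N χ g h) : GermEq N χ h g :=
  let ⟨A, hA, e⟩ := h1
  ⟨A, hA, e.symm⟩

theorem act_eq_of_germEq {χ : SemiChar S} {g h : InvHull S} (hg : χ.1 g.dom = true)
    (hh : χ.1 h.dom = true) (e : GermEq Holds χ g h) : act g χ hg = act h χ hh := by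
  obtain ⟨_, ⟨X, rfl, hX⟩, e⟩ := e
  refine Subtype.ext (funext fun Y => ?_)
  have key : (g.pre Y).inter X = (h.pre Y).inter X := by
    apply Subtype.ext
    ext s
    simp only [ConstrIdeal.inter, InvHull.pre, InvHull.preSet, Set.mem_inter_iff,
      Set.mem_ofPred_eq]
    refine and_congr_left fun hs => ?_
    rw [e hs]
  have h2 := congrArg χ.1 key
  rw [χ.2.1, χ.2.1, hX, Bool.and_true, Bool.and_true] at h2
  exact h2

end SemiChar

variable (S) in
/-- The set `Σ` of pairs `(g, χ)` with `χ(g⁻¹g) = 1`. -/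
def GermPair : Type u := {p : InvHull S × SemiChar S // p.2.1 p.1.dom = true}

variable (S) in
/-- `(g₁, χ₁) ∼_P (g₂, χ₂)`: `χ₁ = χ₂` and `g₁ p_X = g₂ p_X` for some `X` with `χ₁(p_X) = 1`. -/
def patersonSetoid : Setoid (GermPair S) where
  r a b := a.1.2 = b.1.2 ∧ ∃ X : ConstrIdeal S, Set.EqOn a.1.1.1 b.1.1.1 X.1 ∧ a.1.2.1 X = true
  iseqv :=
    { refl := fun a => ⟨rfl, ConstrIdeal.univ, fun _ _ => rfl, a.1.2.univ_eq⟩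
      symm := by
        rintro a b ⟨h, X, e, hX⟩
        exact ⟨h.symm, X, e.symm, h ▸ hX⟩
      trans := by
        rintro a b c ⟨h, X, e, hX⟩ ⟨h', Y, e', hY⟩
        exact ⟨h.trans h', X.inter Y, fun _ hs => (e hs.1).trans (e' hs.2),
          (SemiChar.inter_eq_true _ X Y).2 ⟨hX, h.symm ▸ hY⟩⟩ }

variable (S) in
/-- The groupoid `𝒢(I_ℓ(S)) = Σ / ∼_P`. -/
def Paterson : Type u := Quotient (patersonSetoid S)

namespace Paterson

/-- The class `[g, χ]`. -/
def mk (g : InvHull S) (χ : SemiChar S) (h : χ.1 g.dom = true) : Paterson S :=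
  Quotient.mk (patersonSetoid S) ⟨(g, χ), h⟩

theorem exists_rep (a : Paterson S) : ∃ g χ h, a = mk g χ h := by
  induction a using Quotient.inductionOn with
  | h a => exact ⟨a.1.1, a.1.2, a.2, rfl⟩

theorem mk_eq_iff (g g' : InvHull S) (χ : SemiChar S) (h : χ.1 g.dom = true)
    (h' : χ.1 g'.dom = true) : mk g χ h = mk g' χ h' ↔ SemiChar.GermEq SemiChar.Holds χ g g' := by
  refine Quotient.eq.trans ⟨?_, ?_⟩
  · rintro ⟨_, X, e, hX⟩; exact ⟨X.1, ⟨X, rfl, hX⟩, e⟩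
  · rintro ⟨_, ⟨X, rfl, hX⟩, e⟩; exact ⟨rfl, X, e, hX⟩

/-- The source `s([g, χ]) = χ`. -/
def src (a : Paterson S) : SemiChar S :=
  Quotient.lift (fun a : GermPair S => a.1.2) (by rintro a b ⟨h, _⟩; exact h) a

/-- The range `r([g, χ]) = χ(g⁻¹ · g)`. -/
def rng (a : Paterson S) : SemiChar S :=
  Quotient.lift (fun a : GermPair S => SemiChar.act a.1.1 a.1.2 a.2) (by
    rintro ⟨⟨g, χ⟩, h⟩ ⟨⟨g', χ'⟩, h'⟩ ⟨e, X, e', hX⟩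
    change χ = χ' at e
    subst e
    exact SemiChar.act_eq_of_germEq h h' ⟨X.1, ⟨X, rfl, hX⟩, e'⟩) a

theorem src_mk (g : InvHull S) (χ : SemiChar S) (h : χ.1 g.dom = true) : (mk g χ h).src = χ := rfl

theorem rng_mk (g : InvHull S) (χ : SemiChar S) (h : χ.1 g.dom = true) :
    (mk g χ h).rng = SemiChar.act g χ h := rfl

theorem exists_rep_of_src {a : Paterson S} {χ : SemiChar S} (h : a.src = χ) :
    ∃ g hg, a = mk g χ hg := by
  obtain ⟨g, χ', hg, rfl⟩ := a.exists_rep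
  rw [src_mk] at h
  subst h
  exact ⟨g, hg, rfl⟩

theorem out_spec (a : Paterson S) : mk a.out.1.1 a.out.1.2 a.out.2 = a := Quotient.out_eq a

theorem out_src (a : Paterson S) : a.out.1.2 = a.src := congrArg src a.out_spec

theorem out_rng (a : Paterson S) : SemiChar.act a.out.1.1 a.out.1.2 a.out.2 = a.rng :=
  congrArg rng a.out_spec

/-- The unit `[p_S, χ]`. -/
noncomputable def unit (χ : SemiChar S) : Paterson S :=
  mk InvHull.one χ (by rw [InvHull.one, InvHull.ofElem_dom]; exact χ.univ_eq)

/-- The product `[g, χ] [h, ψ] = [gh, ψ]`, where `χ = ψ(h⁻¹ · h)`. It is computed on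
representatives; `mul_mk` shows that the choice does not matter. -/
noncomputable def mul (a b : Paterson S) (h : a.src = b.rng) : Paterson S :=
  mk (a.out.1.1.mul b.out.1.1) b.out.1.2 (SemiChar.mul_dom _ _ _ b.out.2 (by
    rw [out_rng, ← h, ← out_src]; exact a.out.2))

theorem mul_mk (g h : InvHull S) (χ ψ : SemiChar S) (hg : χ.1 g.dom = true)
    (hh : ψ.1 h.dom = true) (e : χ = SemiChar.act h ψ hh) :
    mul (mk g χ hg) (mk h ψ hh) e =
      mk (g.mul h) ψ (SemiChar.mul_dom _ _ _ hh (e ▸ hg)) := by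
  subst e
  have key : ∀ (a b : GermPair S) (_ : mk a.1.1 a.1.2 a.2 = mk g _ hg)
      (_ : mk b.1.1 b.1.2 b.2 = mk h ψ hh) (p : b.1.2.1 (a.1.1.mul b.1.1).dom = true),
      mk (a.1.1.mul b.1.1) b.1.2 p =
        mk (g.mul h) ψ (SemiChar.mul_dom _ _ _ hh hg) := by
    rintro ⟨⟨g', χ'⟩, hg'⟩ ⟨⟨h', ψ'⟩, hh'⟩ e1 e2 p
    have e3 : χ' = _ := congrArg src e1
    have e4 : ψ' = ψ := congrArg src e2
    subst e4
    subst e3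
    have e1' := (mk_eq_iff _ _ _ _ _).1 e1
    have e2' := (mk_eq_iff _ _ _ _ _).1 e2
    exact (mk_eq_iff _ _ _ _ _).2 (SemiChar.germSys_holds.mul hh e1'.symm e2'.symm).symm
  exact key _ _ (out_spec _) (out_spec _) _

/-- The inverse `[g, χ]⁻¹ = [g⁻¹, χ(g⁻¹ · g)]`, computed on a representative. -/
noncomputable def inv (a : Paterson S) : Paterson S :=
  mk a.out.1.1.inv (SemiChar.act a.out.1.1 a.out.1.2 a.out.2) (SemiChar.act_inv_dom _ _ _)

theorem inv_mk (g : InvHull S) (χ : SemiChar S) (hg : χ.1 g.dom = true) :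
    inv (mk g χ hg) = mk g.inv (SemiChar.act g χ hg) (SemiChar.act_inv_dom _ _ _) := by
  have key : ∀ (a : GermPair S) (_ : mk a.1.1 a.1.2 a.2 = mk g _ hg)
      (p : (SemiChar.act a.1.1 a.1.2 a.2).1 a.1.1.inv.dom = true),
      mk a.1.1.inv (SemiChar.act a.1.1 a.1.2 a.2) p =
        mk g.inv (SemiChar.act g χ hg) (SemiChar.act_inv_dom _ _ _) := by
    rintro ⟨⟨g', χ'⟩, hg'⟩ e1 p
    have e3 : χ' = _ := congrArg src e1
    subst e3
    have e4 : SemiChar.act g' χ' hg' = SemiChar.act g χ' hg := congrArg rng e1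
    rw [mk_eq_iff] at e1
    have e5 := SemiChar.germSys_holds.inv hg' e1
    have : ∀ (η : SemiChar S) (_ : η = SemiChar.act g χ' hg) (q : η.1 g'.inv.dom = true)
        (_ : SemiChar.GermEq SemiChar.Holds η g'.inv g.inv), mk g'.inv η q =
          mk g.inv (SemiChar.act g χ' hg) (SemiChar.act_inv_dom _ _ _) := by
      rintro _ rfl q e
      exact (mk_eq_iff _ _ _ _ _).2 e
    exact this _ e4 _ e5
  exact key _ (out_spec _) _

theorem mk_congr {g g' : InvHull S} {χ χ' : SemiChar S} (e : g = g') (e' : χ = χ')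
    (h : χ.1 g.dom = true) : mk g χ h = mk g' χ' (by rw [← e, ← e']; exact h) := by
  subst e; subst e'; rfl

noncomputable instance : Grpd (SemiChar S) (Paterson S) where
  src := src
  rng := rng
  unit := unit
  inv := inv
  mul := mul
  src_unit _ := rfl
  rng_unit χ := χ.act_one (by rw [InvHull.one, InvHull.ofElem_dom]; exact χ.univ_eq)
  src_inv a := a.out_rng
  rng_inv a := by
    obtain ⟨g, χ, h, rfl⟩ := a.exists_rep
    rw [inv_mk, rng_mk, SemiChar.act_inv_act, src_mk]
  src_mul a b h := b.out_src
  rng_mul a b h := by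
    obtain ⟨k, ψ, hk, rfl⟩ := b.exists_rep
    obtain ⟨g, hg, rfl⟩ := exists_rep_of_src (χ := SemiChar.act k ψ hk) h
    rw [mul_mk _ _ _ _ _ _ rfl]
    exact SemiChar.act_mul ψ g k hk hg
  mul_assoc a b c h h' := by
    obtain ⟨m, χ, hm, rfl⟩ := c.exists_rep
    obtain ⟨k, hk, rfl⟩ := exists_rep_of_src (χ := SemiChar.act m χ hm) h'
    obtain ⟨g, hg, rfl⟩ := exists_rep_of_src (χ := SemiChar.act k _ hk) h
    have e1 := mul_mk g k _ _ hg hk rfl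
    have e2 := mul_mk k m _ _ hk hm rfl
    have e3 : ∀ (x : Paterson S) (_ : x = mk (g.mul k) (SemiChar.act m χ hm)
        (SemiChar.mul_dom _ _ _ hk hg)) (p : x.src = (mk m χ hm).rng),
        mul x (mk m χ hm) p = mk ((g.mul k).mul m) χ
          (SemiChar.mul_dom _ _ _ hm (SemiChar.mul_dom _ _ _ hk hg)) := by
      rintro _ rfl p
      exact mul_mk _ _ _ _ _ _ rfl
    have e4 : ∀ (x : Paterson S) (_ : x = mk (k.mul m) χ (SemiChar.mul_dom _ _ _ hm hk))
        (p : (mk g _ hg).src = x.rng),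
        mul (mk g _ hg) x p = mk (g.mul (k.mul m)) χ
          (SemiChar.mul_dom _ _ _ (SemiChar.mul_dom _ _ _ hm hk)
            (by rw [SemiChar.act_mul]; exact hg)) := by
      rintro _ rfl p
      exact mul_mk _ _ _ _ _ _ p
    rw [e3 _ e1, e4 _ e2]
    exact mk_congr (Subtype.ext (PEquiv.trans_assoc _ _ _).symm) rfl _
  mul_unit a := by
    obtain ⟨g, χ, h, rfl⟩ := a.exists_rep
    refine (mul_mk g InvHull.one χ χ h _ (χ.act_one _).symm).trans ?_
    refine mk_congr (Subtype.ext ?_) rfl _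
    change InvHull.one.1.trans g.1 = g.1
    rw [InvHull.one_val, PEquiv.refl_trans]
  unit_mul a := by
    obtain ⟨g, χ, h, rfl⟩ := a.exists_rep
    refine (mul_mk InvHull.one g _ χ _ h rfl).trans ?_
    refine mk_congr (Subtype.ext ?_) rfl _
    change g.1.trans InvHull.one.1 = g.1
    rw [InvHull.one_val, PEquiv.trans_refl]
  inv_mul a := by
    obtain ⟨g, χ, h, rfl⟩ := a.exists_rep
    have e : ∀ (x : Paterson S)
        (_ : x = mk g.inv (SemiChar.act g χ h) (SemiChar.act_inv_dom _ _ _)) (p : x.src = (mk g χ h).rng),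
        mul x (mk g χ h) p = mk (g.inv.mul g) χ
          (SemiChar.mul_dom _ _ _ h (SemiChar.act_inv_dom _ _ _)) := by
      rintro _ rfl p
      exact mul_mk _ _ _ _ _ _ rfl
    refine (e _ (inv_mk g χ h) _).trans ?_
    refine (mk_eq_iff _ _ _ _ _).2 ⟨_, ⟨g.dom, rfl, h⟩, fun s hs => ?_⟩
    obtain ⟨t, ht⟩ := Option.isSome_iff_exists.1 hs
    change (g.1 s).bind g.1.symm = InvHull.one.1 s
    rw [ht, InvHull.one_val, PEquiv.refl_apply]
    exact (PEquiv.eq_some_iff g.1).2 ht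
  mul_inv a := by
    obtain ⟨g, χ, h, rfl⟩ := a.exists_rep
    have e : ∀ (x : Paterson S)
        (_ : x = mk g.inv (SemiChar.act g χ h) (SemiChar.act_inv_dom _ _ _)) (p : (mk g χ h).src = x.rng),
        mul (mk g χ h) x p = mk (g.mul g.inv) (SemiChar.act g χ h)
          (SemiChar.mul_dom _ _ _ (SemiChar.act_inv_dom _ _ _)
            (by rw [SemiChar.act_inv_act]; exact h)) := by
      rintro _ rfl p
      exact mul_mk _ _ _ _ _ _ p
    refine (e _ (inv_mk g χ h) _).trans ?_
    refine (mk_eq_iff _ _ _ _ _).2 ⟨_, ⟨g.inv.dom, rfl, SemiChar.act_inv_dom _ _ _⟩,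
      fun s hs => ?_⟩
    obtain ⟨t, ht⟩ := Option.isSome_iff_exists.1 hs
    change (g.1.symm s).bind g.1 = InvHull.one.1 s
    have ht' : g.1.symm s = some t := ht
    rw [ht', InvHull.one_val, PEquiv.refl_apply]
    exact (PEquiv.eq_some_iff g.1).1 ht

/-- `D(g, U) = {[g, χ] | χ ∈ U}`. -/
def basicSet (g : InvHull S) (U : Set (SemiChar S)) : Set (Paterson S) :=
  {a | ∃ χ h, χ ∈ U ∧ a = mk g χ h}

/-- The topology with basis the sets `D(g, U)`, `U ⊆ {χ | χ(g⁻¹g) = 1}` open. -/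
instance : TopologicalSpace (Paterson S) :=
  TopologicalSpace.generateFrom
    {D | ∃ (g : InvHull S) (U : Set (SemiChar S)), IsOpen U ∧ U ⊆ {χ | χ.1 g.dom = true} ∧
      D = basicSet g U}

end Paterson

variable (S) in
/-- `Ω(S)`: the closure of the orbit of `χ_e`, that is, of `{χ_s | s ∈ S}`. -/
def omegaSet : Set (SemiChar S) := closure (Set.range SemiChar.point)

theorem point_mem_omegaSet (s : S) : SemiChar.point s ∈ omegaSet S := subset_closure ⟨s, rfl⟩

theorem mem_omegaSet_iff (χ : SemiChar S) :
    χ ∈ omegaSet S ↔ ∀ F : Finset (ConstrIdeal S), ∃ s, ∀ Y ∈ F, (χ.1 Y = true ↔ s ∈ Y.1) := by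
  rw [omegaSet, mem_closure_iff]
  constructor
  · intro h F
    obtain ⟨_, h1, s, rfl⟩ := h (⋂ Y ∈ F, {ψ : SemiChar S | ψ.1 Y = χ.1 Y})
      (isOpen_biInter_finset fun Y _ => (isOpen_discrete ({χ.1 Y} : Set Bool)).preimage
        (f := fun ψ : SemiChar S => ψ.1 Y) ((continuous_apply Y).comp continuous_subtype_val)) (by simp)
    refine ⟨s, fun Y hY => ?_⟩
    rw [← SemiChar.point_eq_true]
    have : (SemiChar.point s).1 Y = χ.1 Y := by simpa using Set.mem_iInter₂.1 h1 Y hY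
    rw [this]
  · intro h o ho hχ
    obtain ⟨u, hu, rfl⟩ := isOpen_induced_iff.1 ho
    obtain ⟨F, v, hv, hv'⟩ := isOpen_pi_iff.1 hu χ.1 hχ
    obtain ⟨s, hs⟩ := h F
    refine ⟨SemiChar.point s, hv' fun Y hY => ?_, s, rfl⟩
    have : (SemiChar.point s).1 Y = χ.1 Y := by
      rw [Bool.eq_iff_iff, SemiChar.point_eq_true, hs Y hY]
    rw [this]
    exact (hv Y hY).2

theorem act_mem_omegaSet {χ : SemiChar S} (hχ : χ ∈ omegaSet S) (g : InvHull S)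
    (h : χ.1 g.dom = true) : SemiChar.act g χ h ∈ omegaSet S := by
  classical
  rw [mem_omegaSet_iff] at hχ ⊢
  intro F
  obtain ⟨s, hs⟩ := hχ (insert g.dom (F.image g.pre))
  have h1 := (hs g.dom (Finset.mem_insert_self _ _)).1 h
  obtain ⟨t, ht⟩ := Option.isSome_iff_exists.1 h1
  refine ⟨t, fun Y hY => (hs (g.pre Y)
    (Finset.mem_insert_of_mem (Finset.mem_image_of_mem _ hY))).trans ?_⟩
  constructor
  · rintro ⟨t', ht', e⟩
    rw [ht, Option.some.injEq] at e
    subst e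
    exact ht'
  · exact fun hY => ⟨t, hY, ht⟩

theorem Paterson.rng_mem_omegaSet (a : Paterson S) (h : Grpd.src a ∈ omegaSet S) :
    Grpd.rng a ∈ omegaSet S := by
  obtain ⟨g, χ, hg, rfl⟩ := a.exists_rep
  exact act_mem_omegaSet h g hg

/-- The orbit of `χ_e` is `{χ_s | s ∈ S}`. -/
theorem orbit_point_one :
    {χ | ∃ a : Paterson S, Grpd.src a = SemiChar.point 1 ∧ Grpd.rng a = χ} =
      Set.range (SemiChar.point (S := S)) := by
  have key : ∀ (g : InvHull S) (h : (SemiChar.point (1 : S)).1 g.dom = true) (s : S),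
      g.1 1 = some s → SemiChar.act g (SemiChar.point 1) h = SemiChar.point s := by
    intro g h s hs
    refine Subtype.ext (funext fun X => ?_)
    rw [Bool.eq_iff_iff, SemiChar.point_eq_true]
    refine (SemiChar.point_eq_true _ _).trans ?_
    constructor
    · rintro ⟨t, ht, e⟩
      rw [hs, Option.some.injEq] at e
      subst e
      exact ht
    · exact fun hX => ⟨s, hX, hs⟩
  ext χ
  constructor
  · rintro ⟨a, h, rfl⟩
    obtain ⟨g, hg, rfl⟩ := Paterson.exists_rep_of_src h
    obtain ⟨s, hs⟩ := Option.isSome_iff_exists.1 ((SemiChar.point_eq_true _ _).1 hg)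
    exact ⟨s, (key g hg s hs).symm⟩
  · rintro ⟨s, rfl⟩
    refine ⟨Paterson.mk (InvHull.ofElem s) (SemiChar.point 1)
      (by rw [InvHull.ofElem_dom]; exact SemiChar.univ_eq _), rfl,
        key (InvHull.ofElem s) (by rw [InvHull.ofElem_dom]; exact SemiChar.univ_eq _) s ?_⟩
    simp [InvHull.ofElem, leftTranslation_apply]

variable (S) in
/-- The groupoid `𝒢_P(S)`: the reduction of `𝒢(I_ℓ(S))` to `Ω(S)`, with the relative topology. -/
abbrev GroupoidP : Type u := {a : Paterson S // Grpd.src a ∈ omegaSet S}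

noncomputable instance : Grpd (omegaSet S) (GroupoidP S) :=
  Grpd.reduction (omegaSet S) Paterson.rng_mem_omegaSet

namespace GroupoidP

/-- The class `[g, χ]`, for `χ ∈ Ω(S)`. -/
def mk (g : InvHull S) (χ : SemiChar S) (hχ : χ ∈ omegaSet S) (h : χ.1 g.dom = true) :
    GroupoidP S := ⟨Paterson.mk g χ h, hχ⟩

theorem exists_rep (a : GroupoidP S) : ∃ g χ hχ h, a = mk g χ hχ h := by
  obtain ⟨g, χ, h, e⟩ := a.1.exists_rep
  have e' : Grpd.src a.1 = χ := congrArg Paterson.src e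
  exact ⟨g, χ, e' ▸ a.2, h, Subtype.ext e⟩

/-- `[g, χ] ∼ [h, χ]`: there is a set `A = X \ (X₁ ∪ ⋯ ∪ X_m)` with `χ(p_A) = 1` and
`g|_A = h|_A`. -/
def Rel (a b : GroupoidP S) : Prop :=
  ∃ (χ : SemiChar S) (hχ : χ ∈ omegaSet S) (g h : InvHull S) (hg : χ.1 g.dom = true)
    (hh : χ.1 h.dom = true), a = mk g χ hχ hg ∧ b = mk h χ hχ hh ∧
      ∃ A, χ.HoldsExt A ∧ Set.EqOn g.1 h.1 A

theorem holds_to_ext {χ : SemiChar S} {g h : InvHull S}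
    (e : SemiChar.GermEq SemiChar.Holds χ g h) : SemiChar.GermEq SemiChar.HoldsExt χ g h := by
  obtain ⟨_, ⟨X, rfl, hX⟩, e⟩ := e
  exact ⟨X.1, SemiChar.germSys_holdsExt.ideal χ X hX, e⟩

theorem rel_mk_iff (g h : InvHull S) (χ : SemiChar S) (hχ : χ ∈ omegaSet S)
    (hg : χ.1 g.dom = true) (hh : χ.1 h.dom = true) :
    Rel (mk g χ hχ hg) (mk h χ hχ hh) ↔ ∃ A, χ.HoldsExt A ∧ Set.EqOn g.1 h.1 A := by
  constructor
  · rintro ⟨χ', hχ', g', h', hg', hh', e1, e2, e3⟩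
    have e4 : χ = χ' := congrArg (fun a : GroupoidP S => a.1.src) e1
    subst e4
    have e5 := (Paterson.mk_eq_iff _ _ _ _ _).1 (congrArg Subtype.val e1)
    have e6 := (Paterson.mk_eq_iff _ _ _ _ _).1 (congrArg Subtype.val e2)
    have G := SemiChar.germSys_holdsExt (S := S)
    exact G.trans (G.trans (holds_to_ext e5) e3) (holds_to_ext e6).symm
  · exact fun e => ⟨χ, hχ, g, h, hg, hh, rfl, rfl, e⟩

variable (S) in
/-- The equivalence relation `∼` on `𝒢_P(S)`. -/
def setoid : Setoid (GroupoidP S) where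
  r := Rel
  iseqv :=
    { refl := fun a => by
        obtain ⟨g, χ, hχ, h, rfl⟩ := a.exists_rep
        exact (rel_mk_iff _ _ _ _ _ _).2 (SemiChar.germSys_holdsExt.refl χ g)
      symm := by
        rintro _ _ ⟨χ, hχ, g, h, hg, hh, rfl, rfl, e⟩
        exact (rel_mk_iff _ _ _ _ _ _).2 (SemiChar.GermEq.symm e)
      trans := by
        rintro _ b c ⟨χ, hχ, g, h, hg, hh, rfl, rfl, e⟩ ⟨χ', hχ', g', h', hg', hh', e1, rfl, e3⟩
        have e4 : χ = χ' := congrArg (fun a : GroupoidP S => a.1.src) e1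
        subst e4
        have e5 := (Paterson.mk_eq_iff _ _ _ _ _).1 (congrArg Subtype.val e1)
        have G := SemiChar.germSys_holdsExt (S := S)
        exact (rel_mk_iff _ _ _ _ _ _).2 (G.trans (G.trans e (holds_to_ext e5)) e3) }

theorem act_eq_of_ext {χ : SemiChar S} (hχ : χ ∈ omegaSet S) {g h : InvHull S}
    (hg : χ.1 g.dom = true) (hh : χ.1 h.dom = true)
    (e : SemiChar.GermEq SemiChar.HoldsExt χ g h) :
    SemiChar.act g χ hg = SemiChar.act h χ hh := by
  classical
  obtain ⟨_, ⟨X, F, rfl, hX, hF⟩, e⟩ := e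
  refine Subtype.ext (funext fun Y => ?_)
  obtain ⟨s, hs⟩ := (mem_omegaSet_iff χ).1 hχ (insert X (insert (g.pre Y) (insert (h.pre Y) F)))
  have hsA : s ∈ X.1 \ ⋃ Y ∈ F, Y.1 := by
    refine ⟨(hs X (by simp)).1 hX, ?_⟩
    intro hmem
    obtain ⟨Z, hZ, hsZ⟩ := Set.mem_iUnion₂.1 hmem
    have := (hs Z (by simp [hZ])).2 hsZ
    rw [hF Z hZ] at this
    exact Bool.noConfusion this
  rw [Bool.eq_iff_iff]
  refine (hs (g.pre Y) (by simp)).trans (Iff.trans ?_ (hs (h.pre Y) (by simp)).symm)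
  simp only [InvHull.pre, InvHull.preSet, Set.mem_ofPred_eq]
  rw [e hsA]

theorem src_eq_of_rel {a b : GroupoidP S} (h : Rel a b) : Grpd.src a = Grpd.src b := by
  obtain ⟨χ, hχ, g, h, hg, hh, rfl, rfl, e⟩ := h
  rfl

theorem rng_eq_of_rel {a b : GroupoidP S} (h : Rel a b) : Grpd.rng a = Grpd.rng b := by
  obtain ⟨χ, hχ, g, h, hg, hh, rfl, rfl, e⟩ := h
  exact Subtype.ext (act_eq_of_ext hχ hg hh e)

theorem mul_rel {a b a' b' : GroupoidP S} (h1 : Rel a a') (h2 : Rel b b')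
    (h : Grpd.src a = Grpd.rng b) (h' : Grpd.src a' = Grpd.rng b') :
    Rel (Grpd.mul a b h) (Grpd.mul a' b' h') := by
  obtain ⟨ψ, hψ, k, k', hk, hk', rfl, rfl, e2⟩ := h2
  obtain ⟨χ, hχ, g, g', hg, hg', rfl, rfl, e1⟩ := h1
  have hc : χ = SemiChar.act k ψ hk := congrArg Subtype.val h
  have hc' : χ = SemiChar.act k' ψ hk' := congrArg Subtype.val h'
  refine ⟨ψ, hψ, g.mul k, g'.mul k', SemiChar.mul_dom _ _ _ hk (hc ▸ hg),
    SemiChar.mul_dom _ _ _ hk' (hc' ▸ hg'), Subtype.ext (Paterson.mul_mk _ _ _ _ _ _ hc),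
    Subtype.ext (Paterson.mul_mk _ _ _ _ _ _ hc'), ?_⟩
  subst hc
  exact SemiChar.germSys_holdsExt.mul hk e1 e2

theorem inv_rel {a b : GroupoidP S} (h : Rel a b) : Rel (Grpd.inv a) (Grpd.inv b) := by
  obtain ⟨χ, hχ, g, h, hg, hh, rfl, rfl, e⟩ := h
  have e' := act_eq_of_ext hχ hg hh e
  refine ⟨SemiChar.act g χ hg, act_mem_omegaSet hχ g hg, g.inv, h.inv, SemiChar.act_inv_dom _ _ _,
    e' ▸ SemiChar.act_inv_dom _ _ _, Subtype.ext (Paterson.inv_mk _ _ _),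
    Subtype.ext ((Paterson.inv_mk _ _ _).trans (Paterson.mk_congr rfl e'.symm _)),
    SemiChar.germSys_holdsExt.inv hg e⟩

end GroupoidP

variable (S) in
/-- The quotient groupoid `𝒢(S) = 𝒢_P(S) / ∼`. -/
def GroupoidQ : Type u := Quotient (GroupoidP.setoid S)

/-- The quotient map `𝒢_P(S) → 𝒢(S)`. -/
def GroupoidP.toQ (a : GroupoidP S) : GroupoidQ S := Quotient.mk (GroupoidP.setoid S) a

namespace GroupoidQ

/-- The quotient topology. -/
instance : TopologicalSpace (GroupoidQ S) :=
  inferInstanceAs (TopologicalSpace (Quotient (GroupoidP.setoid S)))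

theorem out_spec (a : GroupoidQ S) : a.out.toQ = a := Quotient.out_eq a

theorem toQ_eq_iff (a b : GroupoidP S) : a.toQ = b.toQ ↔ GroupoidP.Rel a b :=
  Quotient.eq (r := GroupoidP.setoid S)

theorem out_rel (a : GroupoidP S) : GroupoidP.Rel a.toQ.out a := (toQ_eq_iff _ _).1 (out_spec _)

theorem exists_rep (a : GroupoidQ S) : ∃ b : GroupoidP S, a = b.toQ := ⟨_, a.out_spec.symm⟩

/-- The source map induced from `𝒢_P(S)`. -/
noncomputable def src (a : GroupoidQ S) : omegaSet S :=
  Quotient.lift (fun a : GroupoidP S => Grpd.src a) (fun _ _ h => GroupoidP.src_eq_of_rel h) a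

/-- The range map induced from `𝒢_P(S)`. -/
noncomputable def rng (a : GroupoidQ S) : omegaSet S :=
  Quotient.lift (fun a : GroupoidP S => Grpd.rng a) (fun _ _ h => GroupoidP.rng_eq_of_rel h) a

/-- The inverse, computed on a representative. -/
noncomputable def inv (a : GroupoidQ S) : GroupoidQ S := (Grpd.inv a.out).toQ

/-- The product, computed on representatives; `mul_toQ` shows that the choice does not matter. -/
noncomputable def mul (a b : GroupoidQ S) (h : a.src = b.rng) : GroupoidQ S :=
  (Grpd.mul a.out b.out (by
    have h1 : Grpd.src a.out = a.src := congrArg src a.out_spec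
    have h2 : Grpd.rng b.out = b.rng := congrArg rng b.out_spec
    rw [h1, h2, h])).toQ

theorem mul_toQ (a b : GroupoidP S) (h : Grpd.src a = Grpd.rng b) :
    mul a.toQ b.toQ h = (Grpd.mul a b h).toQ :=
  (toQ_eq_iff _ _).2 (GroupoidP.mul_rel (out_rel a) (out_rel b) _ _)

theorem inv_toQ (a : GroupoidP S) : inv a.toQ = (Grpd.inv a).toQ :=
  (toQ_eq_iff _ _).2 (GroupoidP.inv_rel (out_rel a))

theorem mul_congr {a a' b b' : GroupoidQ S} (e : a = a') (e' : b = b') (h : a.src = b.rng) :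
    mul a b h = mul a' b' (by rw [← e, ← e', h]) := by subst e; subst e'; rfl

noncomputable instance : Grpd (omegaSet S) (GroupoidQ S) where
  src := src
  rng := rng
  unit x := (Grpd.unit x : GroupoidP S).toQ
  inv := inv
  mul := mul
  src_unit x := Grpd.src_unit (G := GroupoidP S) x
  rng_unit x := Grpd.rng_unit (G := GroupoidP S) x
  src_inv a := by
    obtain ⟨a, rfl⟩ := a.exists_rep
    rw [inv_toQ]; exact Grpd.src_inv a
  rng_inv a := by
    obtain ⟨a, rfl⟩ := a.exists_rep
    rw [inv_toQ]; exact Grpd.rng_inv a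
  src_mul a b h := by
    obtain ⟨a, rfl⟩ := a.exists_rep
    obtain ⟨b, rfl⟩ := b.exists_rep
    rw [mul_toQ _ _ h]; exact Grpd.src_mul a b h
  rng_mul a b h := by
    obtain ⟨a, rfl⟩ := a.exists_rep
    obtain ⟨b, rfl⟩ := b.exists_rep
    rw [mul_toQ _ _ h]; exact Grpd.rng_mul a b h
  mul_assoc a b c h h' := by
    obtain ⟨a, rfl⟩ := a.exists_rep
    obtain ⟨b, rfl⟩ := b.exists_rep
    obtain ⟨c, rfl⟩ := c.exists_rep
    have h1 : Grpd.src a = Grpd.rng b := h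
    have h2 : Grpd.src b = Grpd.rng c := h'
    rw [mul_congr (mul_toQ a b h1) rfl, mul_congr rfl (mul_toQ b c h2),
      mul_toQ _ _ ((Grpd.src_mul _ _ _).trans h2), mul_toQ _ _ (h1.trans (Grpd.rng_mul _ _ _).symm)]
    exact congrArg _ (Grpd.mul_assoc a b c h1 h2)
  mul_unit a := by
    obtain ⟨a, rfl⟩ := a.exists_rep
    exact (mul_toQ a _ (Grpd.rng_unit _).symm).trans (congrArg _ (Grpd.mul_unit a))
  unit_mul a := by
    obtain ⟨a, rfl⟩ := a.exists_rep
    exact (mul_toQ _ a (Grpd.src_unit _)).trans (congrArg _ (Grpd.unit_mul a))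
  inv_mul a := by
    obtain ⟨a, rfl⟩ := a.exists_rep
    rw [mul_congr (inv_toQ a) rfl, mul_toQ _ _ (Grpd.src_inv a)]
    exact congrArg _ (Grpd.inv_mul a)
  mul_inv a := by
    obtain ⟨a, rfl⟩ := a.exists_rep
    rw [mul_congr rfl (inv_toQ a), mul_toQ _ _ (Grpd.rng_inv a).symm]
    exact congrArg _ (Grpd.mul_inv a)

end GroupoidQ

end paterson

/-! ### The reduced semigroup C*-algebra -/

section semigroup

variable (S : Type u) [LeftCancelMonoid S]

variable {S} in
/-- The elements of `I_ℓ(S)` commute with right multiplications. -/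
theorem MemInvHull.map_mul {g : S ≃. S} (hg : MemInvHull g) :
    ∀ t r u, g t = some u → g (t * r) = some (u * r) := by
  induction hg with
  | left s =>
    intro t r u h
    rw [leftTranslation_apply, Option.some.injEq] at h ⊢
    rw [← h, mul_assoc]
  | symm g hg ih =>
    intro t r u h
    rw [PEquiv.eq_some_iff] at h ⊢
    exact ih _ _ _ h
  | trans g h _ _ ihg ihh =>
    intro t r u e
    rw [PEquiv.trans_eq_some] at e ⊢
    obtain ⟨b, h1, h2⟩ := e
    exact ⟨b * r, ihg _ _ _ h1, ihh _ _ _ h2⟩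

variable {S} in
open Classical in
theorem orthonormal_translate (s : S) :
    Orthonormal ℂ (fun t : S => (lp.single 2 (s * t) (1 : ℂ) : EllTwo S)) := by
  rw [orthonormal_iff_ite]
  intro i j
  rw [lp.inner_single_left]
  simp [lp.single_apply, Pi.single_apply]

open Classical in
/-- The left regular representation `λ_s δ_t = δ_{st}`. -/
noncomputable def leftReg {S : Type u} [LeftCancelMonoid S] (s : S) : EllTwo S →L[ℂ] EllTwo S :=
  (orthonormal_translate s).orthogonalFamily.linearIsometry.toContinuousLinearMap

open Classical in
theorem leftReg_single {S : Type u} [LeftCancelMonoid S] (s t : S) :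
    leftReg s (lp.single 2 t (1 : ℂ)) = lp.single 2 (s * t) (1 : ℂ) := by
  refine ((orthonormal_translate s).orthogonalFamily.linearIsometry_apply_single _).trans ?_
  simp

/-- The reduced C*-algebra `C*_r(S)`, generated by the operators `λ_s`. -/
noncomputable def semigroupCStar : StarSubalgebra ℂ (EllTwo S →L[ℂ] EllTwo S) :=
  (StarAlgebra.adjoin ℂ (Set.range (leftReg (S := S)))).topologicalClosure

/-- `χ_e` as an object of `𝒢_P(S)`. -/
noncomputable def chiE : omegaSet S := ⟨SemiChar.point 1, point_mem_omegaSet 1⟩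

/-- The bijection `S → 𝒢_P(S)_{χ_e}`, `s ↦ [s, χ_e]`. -/
noncomputable def fiberMap (s : S) : SrcFiber (GroupoidP S) (chiE S) :=
  ⟨GroupoidP.mk (InvHull.ofElem s) (SemiChar.point 1) (point_mem_omegaSet 1)
    (by rw [InvHull.ofElem_dom]; exact SemiChar.univ_eq _), rfl⟩

theorem fiberMap_bijective : Function.Bijective (fiberMap S) := by
  constructor
  · intro s t h
    have h1 : (fiberMap S s).1.1 = (fiberMap S t).1.1 := by rw [h]
    obtain ⟨_, ⟨X, rfl, hX⟩, e⟩ := (Paterson.mk_eq_iff _ _ _ _ _).1 h1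
    have := e ((SemiChar.point_eq_true _ _).1 hX)
    simpa [InvHull.ofElem, leftTranslation_apply] using this
  · rintro ⟨a, ha⟩
    obtain ⟨g, χ, hχ, hg, rfl⟩ := a.exists_rep
    have e : χ = SemiChar.point 1 := congrArg Subtype.val ha
    subst e
    obtain ⟨s, hs⟩ := Option.isSome_iff_exists.1 ((SemiChar.point_eq_true _ _).1 hg)
    refine ⟨s, Subtype.ext (Subtype.ext ((Paterson.mk_eq_iff _ _ _ _ _).2 ?_))⟩
    refine ⟨_, SemiChar.germSys_holds.ideal _ ConstrIdeal.univ (SemiChar.univ_eq _), ?_⟩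
    intro t _
    change some (s * t) = g.1 t
    have := MemInvHull.map_mul g.2 1 t s hs
    rw [one_mul] at this
    exact this.symm

/-- The bijection `S ≃ 𝒢_P(S)_{χ_e}`, `s ↦ [s, χ_e]`. -/
noncomputable def fiberEquiv : S ≃ SrcFiber (GroupoidP S) (chiE S) :=
  Equiv.ofBijective (fiberMap S) (fiberMap_bijective S)

/-- The unitary `ℓ²(κ) → ℓ²(ι)`, `ξ ↦ ξ ∘ e`, induced by a bijection `e : ι → κ`. -/
noncomputable def ellTwoCongr {ι κ : Type u} (e : ι ≃ κ) : EllTwo κ ≃ₗᵢ[ℂ] EllTwo ι where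
  toFun ξ := ⟨fun i => ξ (e i), by
    have h := lp.memℓp ξ
    rw [memℓp_gen_iff (by norm_num)] at h
    refine (memℓp_gen_iff (by norm_num)).2 ?_
    exact (e.summable_iff (f := fun k => ‖ξ k‖ ^ (2 : ℝ≥0∞).toReal)).2 h⟩
  invFun ξ := ⟨fun i => ξ (e.symm i), by
    have h := lp.memℓp ξ
    rw [memℓp_gen_iff (by norm_num)] at h
    refine (memℓp_gen_iff (by norm_num)).2 ?_
    exact (e.symm.summable_iff (f := fun k => ‖ξ k‖ ^ (2 : ℝ≥0∞).toReal)).2 h⟩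
  map_add' _ _ := rfl
  map_smul' _ _ := rfl
  left_inv ξ := by ext i; simp
  right_inv ξ := by ext i; simp
  norm_map' ξ := by
    rw [lp.norm_eq_tsum_rpow (by norm_num), lp.norm_eq_tsum_rpow (by norm_num)]
    congr 1
    exact e.tsum_eq (fun k => ‖ξ k‖ ^ (2 : ℝ≥0∞).toReal)

/-- The representation `ρ_{χ_e}` of `C*_r(𝒢_P(S))`, viewed as a representation on `ℓ²(S)` through
the bijection `s ↦ [s, χ_e]`. -/
noncomputable def rhoChiE (a : reducedCStar (GroupoidP S)) : EllTwo S →L[ℂ] EllTwo S :=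
  (ellTwoCongr (fiberEquiv S)).conjStarAlgEquiv (rho (GroupoidP S) (chiE S) a)

/-- `ρ_{χ_e}` defines an isomorphism `C*_r(𝒢_P(S)) ≅ C*_r(S)`. -/
def RhoDefinesIso : Prop :=
  ∃ φ : reducedCStar (GroupoidP S) ≃⋆ₐ[ℂ] semigroupCStar S,
    ∀ a, (φ a : EllTwo S →L[ℂ] EllTwo S) = rhoChiE S a

/-- Strong C*-regularity: whenever `∅ ≠ X \ (X₁ ∪ ⋯ ∪ X_m) ⊆ ⋃_k {s | h_k s = s}`, there are
constructible ideals `Y₁, …, Y_l` covering `X \ (X₁ ∪ ⋯ ∪ X_m)` and indices `k_j` such that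
`h_{k_j} p_{Y_j} = p_{Y_j}`. -/
def StronglyCStarRegular : Prop :=
  ∀ (n m : ℕ) (h : Fin n → InvHull S) (X : ConstrIdeal S) (Xs : Fin m → ConstrIdeal S),
    (X.1 \ ⋃ i, (Xs i).1).Nonempty →
    X.1 \ ⋃ i, (Xs i).1 ⊆ ⋃ k, {s | (h k).1 s = some s} →
    ∃ (l : ℕ) (Y : Fin l → ConstrIdeal S) (k : Fin l → Fin n),
      X.1 \ ⋃ i, (Xs i).1 ⊆ ⋃ j, (Y j).1 ∧ ∀ j, ∀ s ∈ (Y j).1, (h (k j)).1 s = some s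

end semigroup

/-! Both parts amount to showing that `∼` is trivial on `𝒢_P(S)`. Let `[g, χ] ∼ [h, χ]`, so that
`g = h` on some `X \ (X₁ ∪ ⋯ ∪ X_m)` with `χ(p_X) = 1` and `χ(p_{X_i}) = 0`, and let `U` be the set
of semi-characters in the domains of `g` and `h` satisfying the latter conditions. The germs of `g`
and of `h` over `U ∩ Ω(S)` form two compact open bisections `B` and `C`. They agree over the orbit
`{χ_s}` of `χ_e`, because `[g, χ_s]` only depends on `g s`; hence
`ρ_{χ_e}(1_B) = ρ_{χ_e}(1_C)`. If `ρ_{χ_e}` is faithful, then `1_B = 1_C` in `C*_r(𝒢_P(S))`, and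
evaluating `ρ_χ` at the unit vector of `χ` gives `B = C`, so `[g, χ] = [h, χ]`. For the regularity
condition, `g⁻¹h` fixes `(X ∩ dom g) \ (X₁ ∪ ⋯ ∪ X_m)` pointwise; since `χ` is a limit of point
characters, one of the finitely many ideals `Y` provided by the condition has `χ(p_Y) = 1`. -/

/-! ### Partial permutations of coordinates -/

section lp

variable {ι κ 𝕜 E : Type*} (f : ι → Option κ)

theorem sum_filterMap_eq_sum_elim {M : Type*} [AddCommMonoid M]
    (hf : ∀ i j k, k ∈ f i → k ∈ f j → i = j) (s : Finset ι) (φ : κ → M) :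
    ∑ k ∈ s.filterMap f hf, φ k = ∑ i ∈ s, (f i).elim 0 φ := by
  rw [Finset.sum, Finset.filterMap_val, Finset.sum]
  induction s.val using Multiset.induction_on with
  | empty => simp
  | cons i t ih => cases h : f i <;> simp [h, ih]

variable [NormedAddCommGroup E] {p : ℝ≥0∞}

theorem sum_norm_elim_rpow_le (hf : ∀ i j k, k ∈ f i → k ∈ f j → i = j)
    (hp : 0 < p.toReal) (ξ : lp (fun _ : κ => E) p) (s : Finset ι) :
    ∑ i ∈ s, ‖(f i).elim 0 ξ‖ ^ p.toReal ≤ ‖ξ‖ ^ p.toReal :=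
  calc ∑ i ∈ s, ‖(f i).elim 0 ξ‖ ^ p.toReal
      = ∑ i ∈ s, (f i).elim 0 fun k => ‖ξ k‖ ^ p.toReal :=
        Finset.sum_congr rfl fun i _ => by cases f i <;> simp [hp.ne']
    _ = ∑ k ∈ s.filterMap f hf, ‖ξ k‖ ^ p.toReal := (sum_filterMap_eq_sum_elim f hf s _).symm
    _ ≤ ‖ξ‖ ^ p.toReal := lp.sum_rpow_le_norm_rpow hp ξ _

variable (𝕜) [NontriviallyNormedField 𝕜] [NormedSpace 𝕜 E] [Fact (1 ≤ p)]

/-- The contraction `ℓᵖ(κ, E) → ℓᵖ(ι, E)` given by composition with an injective partial map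
`f : ι ⇀ κ`, with value `0` outside the domain of `f`. -/
noncomputable def lpPartialComp (hf : ∀ i j k, k ∈ f i → k ∈ f j → i = j)
    (hp : 0 < p.toReal) : lp (fun _ : κ => E) p →L[𝕜] lp (fun _ : ι => E) p :=
  LinearMap.mkContinuous
    { toFun := fun ξ => ⟨fun i => (f i).elim 0 ξ, memℓp_gen' (sum_norm_elim_rpow_le f hf hp ξ)⟩
      map_add' := fun ξ η => by
        ext i
        change (f i).elim 0 (ξ + η : lp (fun _ : κ => E) p) = (f i).elim 0 ξ + (f i).elim 0 η
        cases f i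
        exacts [(add_zero (0 : E)).symm, rfl]
      map_smul' := fun c ξ => by
        ext i
        change (f i).elim 0 (c • ξ : lp (fun _ : κ => E) p) = c • (f i).elim 0 ξ
        cases f i
        exacts [(smul_zero c).symm, rfl] }
    1 fun ξ => by
      rw [one_mul]
      exact lp.norm_le_of_forall_sum_le hp (norm_nonneg _) (sum_norm_elim_rpow_le f hf hp ξ)

theorem lpPartialComp_apply (hf : ∀ i j k, k ∈ f i → k ∈ f j → i = j)
    (hp : 0 < p.toReal) (ξ : lp (fun _ : κ => E) p) (i : ι) :
    lpPartialComp 𝕜 f hf hp ξ i = (f i).elim 0 ξ := rfl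

theorem norm_lpPartialComp_le (hf : ∀ i j k, k ∈ f i → k ∈ f j → i = j)
    (hp : 0 < p.toReal) :
    ‖(lpPartialComp 𝕜 f hf hp : lp (fun _ : κ => E) p →L[𝕜] lp (fun _ : ι => E) p)‖ ≤ 1 :=
  LinearMap.mkContinuous_norm_le _ zero_le_one _

end lp

/-! ### Bisections in the reduced groupoid C*-algebra -/

namespace Grpd

variable {X : Type u} {G : Type v} [Grpd X G]

variable (G) in
/-- The orbit of the object `x`. -/
def orbit (x : X) : Set X := {y | ∃ a : G, src a = x ∧ rng a = y}

theorem mul_congr {a a' b b' : G} (ha : a = a') (hb : b = b') (h : src a = rng b) :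
    mul a b h = mul a' b' (ha ▸ hb ▸ h) := by
  subst ha hb
  rfl

theorem mul_inv_mul (a b : G) (h : rng a = rng b) :
    mul a (mul (inv a) b ((src_inv a).trans h)) (by rw [rng_mul, rng_inv]) = b :=
  calc mul a (mul (inv a) b ((src_inv a).trans h)) (by rw [rng_mul, rng_inv])
      = mul (mul a (inv a) (rng_inv a).symm) b (by rw [src_mul, src_inv, h]) :=
        (mul_assoc _ _ _ _ _).symm
    _ = mul (unit (rng b)) b (src_unit _) := mul_congr ((mul_inv a).trans (by rw [h])) rfl _
    _ = b := unit_mul b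

/-- A set of arrows on which the source and the range map are injective. -/
structure IsBisection (B : Set G) : Prop where
  src_injOn : Set.InjOn (src : G → X) B
  rng_injOn : Set.InjOn (rng : G → X) B

/-- A compact open bisection. The Hausdorff property is a separate condition, since `X` carries no
topology here and `G` need not be Hausdorff. -/
structure IsCompactOpenBisection [TopologicalSpace G] (B : Set G) : Prop
    extends IsBisection B where
  isOpen : IsOpen B
  isCompact : IsCompact B
  t2Space : T2Space B

end Grpd

namespace SrcFiber

variable {X : Type u} {G : Type v} [Grpd X G] {x : X}

theorem rng_invMul (a : SrcFiber G x) (k : G) (h : Grpd.rng k = Grpd.rng a.1) :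
    Grpd.rng (a.invMul k h).1 = Grpd.src k :=
  (Grpd.rng_mul _ _ _).trans (Grpd.rng_inv _)

theorem mul_invMul (a : SrcFiber G x) (k : G) (h : Grpd.rng k = Grpd.rng a.1) :
    Grpd.mul k (a.invMul k h).1 (a.rng_invMul k h).symm = a.1 := Grpd.mul_inv_mul k a.1 h

variable (x) in
/-- The unit of `x` as an element of `G_x`. -/
def unit : SrcFiber G x := ⟨Grpd.unit x, Grpd.src_unit x⟩

theorem invMul_eq_unit_iff (a : SrcFiber G x) (k : G) (h : Grpd.rng k = Grpd.rng a.1) :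
    a.invMul k h = unit x ↔ k = a.1 := by
  constructor
  · intro e
    have hk : Grpd.src k = x := by rw [← a.rng_invMul k h, e, unit, Grpd.rng_unit]
    subst hk
    calc k = Grpd.mul k (Grpd.unit (Grpd.src k)) (Grpd.rng_unit _).symm := (Grpd.mul_unit k).symm
      _ = Grpd.mul k (a.invMul k h).1 (a.rng_invMul k h).symm :=
        Grpd.mul_congr rfl (congrArg Subtype.val e).symm _
      _ = a.1 := a.mul_invMul k h
  · rintro rfl
    obtain ⟨a, rfl⟩ := a
    exact Subtype.ext (Grpd.inv_mul a)

end SrcFiber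

namespace IsRho

variable {X : Type u} {G : Type v} [Grpd X G] {x : X} {f f' : G → ℂ}

theorem eq_of_eqOn_orbit {T T' : EllTwo (SrcFiber G x) →L[ℂ] EllTwo (SrcFiber G x)}
    (hT : IsRho x f T) (hT' : IsRho x f' T')
    (hf : ∀ k, Grpd.src k ∈ Grpd.orbit G x → f k = f' k) : T = T' := by
  ext ξ a
  rw [hT, hT']
  refine tsum_congr fun ⟨k, hk⟩ => ?_
  rw [hf k ⟨_, (a.invMul k hk).2, a.rng_invMul k hk⟩]

open Classical in
theorem apply_single_unit {T : EllTwo (SrcFiber G x) →L[ℂ] EllTwo (SrcFiber G x)}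
    (hT : IsRho x f T) (a : SrcFiber G x) : T (lp.single 2 (SrcFiber.unit x) 1) a = f a.1 := by
  rw [hT, tsum_eq_single ⟨a.1, rfl⟩]
  · rw [(a.invMul_eq_unit_iff a.1 rfl).2 rfl, lp.single_apply_self, mul_one]
  · rintro ⟨k, hk⟩ hne
    have hka : a.invMul k hk ≠ SrcFiber.unit x := fun e =>
      hne (Subtype.ext ((a.invMul_eq_unit_iff k hk).1 e))
    rw [lp.single_apply_ne _ _ _ hka, mul_zero]

theorem function_unique {T : ∀ x : X, EllTwo (SrcFiber G x) →L[ℂ] EllTwo (SrcFiber G x)}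
    (hf : ∀ x, IsRho x f (T x)) (hf' : ∀ x, IsRho x f' (T x)) : f = f' := by
  classical
  funext k
  rw [← (hf (Grpd.src k)).apply_single_unit ⟨k, rfl⟩,
    (hf' (Grpd.src k)).apply_single_unit ⟨k, rfl⟩]

end IsRho

section bisection

variable {X : Type u} {G : Type v} [Grpd X G] {B C : Set G}

open Classical in
/-- The partial map `a ↦ k⁻¹a` of `G_x`, defined when there is a `k ∈ B` with `r(k) = r(a)`. -/
noncomputable def bisectionAct (B : Set G) (x : X) (a : SrcFiber G x) : Option (SrcFiber G x) :=
  if h : ∃ k ∈ B, Grpd.rng k = Grpd.rng a.1 then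
    some (a.invMul h.choose h.choose_spec.2) else none

theorem exists_invMul_eq_of_mem_bisectionAct {x : X} {a c : SrcFiber G x}
    (hc : c ∈ bisectionAct B x a) :
    ∃ k ∈ B, ∃ h : Grpd.rng k = Grpd.rng a.1, a.invMul k h = c := by
  unfold bisectionAct at hc
  split_ifs at hc with h
  · exact ⟨_, h.choose_spec.1, h.choose_spec.2, Option.some.inj hc⟩
  · simp at hc

namespace Grpd.IsBisection

theorem bisectionAct_injective (hB : IsBisection B) (x : X) (a b c : SrcFiber G x)
    (ha : c ∈ bisectionAct B x a) (hb : c ∈ bisectionAct B x b) : a = b := by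
  obtain ⟨k, hk, hka, hac⟩ := exists_invMul_eq_of_mem_bisectionAct ha
  obtain ⟨l, hl, hlb, hbc⟩ := exists_invMul_eq_of_mem_bisectionAct hb
  obtain rfl : k = l := hB.src_injOn hk hl <| by
    rw [← a.rng_invMul k hka, ← b.rng_invMul l hlb, hac, hbc]
  apply Subtype.ext
  rw [← a.mul_invMul k hka, ← b.mul_invMul k hlb]
  exact mul_congr rfl (congrArg Subtype.val (hac.trans hbc.symm)) _

theorem bisectionAct_eq_some (hB : IsBisection B) {x : X} {a : SrcFiber G x} {k : G} (hk : k ∈ B)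
    (h : rng k = rng a.1) : bisectionAct B x a = some (a.invMul k h) := by
  have hex : ∃ k ∈ B, rng k = rng a.1 := ⟨k, hk, h⟩
  obtain rfl : k = hex.choose :=
    hB.rng_injOn hk hex.choose_spec.1 (h.trans hex.choose_spec.2.symm)
  exact dif_pos hex

/-- The partial isometry `ρ_x(1_B)`. -/
noncomputable def op (hB : IsBisection B) (x : X) :
    EllTwo (SrcFiber G x) →L[ℂ] EllTwo (SrcFiber G x) :=
  lpPartialComp ℂ (bisectionAct B x) (hB.bisectionAct_injective x) (by norm_num)

theorem isRho_op (hB : IsBisection B) (x : X) : IsRho x (B.indicator 1) (hB.op x) := by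
  intro ξ a
  rw [op, lpPartialComp_apply]
  by_cases h : ∃ k ∈ B, rng k = rng a.1
  · obtain ⟨k, hkB, hka⟩ := h
    rw [hB.bisectionAct_eq_some hkB hka, tsum_eq_single ⟨k, hka⟩, Set.indicator_of_mem hkB,
      Pi.one_apply, one_mul, Option.elim_some]
    rintro ⟨l, hl⟩ hne
    have hlB : l ∉ B := fun hlB => hne (Subtype.ext (hB.rng_injOn hlB hkB (hl.trans hka.symm)))
    rw [Set.indicator_of_notMem hlB, zero_mul]
  · have hzero (l : {l : G // rng l = rng a.1}) :
        (B.indicator 1 l.1 : ℂ) * ξ (a.invMul l.1 l.2) = 0 := by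
      rw [Set.indicator_of_notMem fun hlB => h ⟨l.1, hlB, l.2⟩, zero_mul]
    rw [bisectionAct, dif_neg h, Option.elim_none, tsum_congr hzero, tsum_zero]

/-- The family `(ρ_x(1_B))_x`. -/
noncomputable def opFamily (hB : IsBisection B) : FiberOps G :=
  ⟨hB.op, memℓp_infty ⟨1, by
    rintro _ ⟨x, rfl⟩
    exact norm_lpPartialComp_le _ _ _ _⟩⟩

end Grpd.IsBisection

namespace Grpd.IsCompactOpenBisection

variable [TopologicalSpace G]

theorem indicator_mem_ccSpan (hB : IsCompactOpenBisection B) :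
    (B.indicator 1 : G → ℂ) ∈ CcSpan G :=
  Submodule.subset_span ⟨B, hB.isOpen, hB.t2Space,
    continuousOn_const.congr fun _ hk => Set.indicator_of_mem hk _,
    B, subset_rfl, hB.isCompact, fun _ hk => Set.indicator_of_notMem hk _⟩

theorem opFamily_mem_reducedCStar (hB : IsCompactOpenBisection B) :
    hB.opFamily ∈ reducedCStar G :=
  NonUnitalStarSubalgebra.le_topologicalClosure _
    (NonUnitalStarAlgebra.subset_adjoin ℂ _ ⟨_, hB.indicator_mem_ccSpan, hB.isRho_op⟩)

theorem eq_of_injective_rho (hB : IsCompactOpenBisection B) (hC : IsCompactOpenBisection C) {x : X}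
    (hρ : Function.Injective (rho G x)) (hBC : ∀ k, src k ∈ orbit G x → (k ∈ B ↔ k ∈ C)) :
    B = C := by
  classical
  have hop : hB.op x = hC.op x :=
    (hB.isRho_op x).eq_of_eqOn_orbit (hC.isRho_op x) fun k hk => by
      simp only [Set.indicator_apply, hBC k hk]
  have hfamily : (⟨hB.opFamily, hB.opFamily_mem_reducedCStar⟩ : reducedCStar G) =
      ⟨hC.opFamily, hC.opFamily_mem_reducedCStar⟩ := hρ hop
  have hops : hB.op = hC.op :=
    congrArg (fun a : reducedCStar G => (a.1.1 : ∀ x : X, _)) hfamily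
  exact Set.indicator_one_inj ℂ (IsRho.function_unique hB.isRho_op (hops ▸ hC.isRho_op))

end Grpd.IsCompactOpenBisection

end bisection

/-! ### The topology of the groupoid of germs -/

section paterson

variable {S : Type u} [LeftCancelMonoid S]

namespace SemiChar

theorem isClopen_setOf_eq (X : ConstrIdeal S) (b : Bool) :
    IsClopen {χ : SemiChar S | χ.1 X = b} :=
  (isClopen_discrete {b}).preimage ((continuous_apply X).comp continuous_subtype_val)

instance : CompactSpace (SemiChar S) := by
  have heq : {χ : ConstrIdeal S → Bool |
      (∀ X Y, χ (X.inter Y) = (χ X && χ Y)) ∧ ∃ X, χ X = true} =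
      (⋂ X, ⋂ Y, {χ | χ (X.inter Y) = (χ X && χ Y)}) ∩ {χ | χ ConstrIdeal.univ = true} := by
    ext χ
    simp only [Set.mem_inter_iff, Set.mem_iInter, Set.mem_ofPred_eq]
    exact and_congr_right fun h => ⟨fun h' => univ_eq ⟨χ, h, h'⟩, fun h' => ⟨_, h'⟩⟩
  have hand (X Y : ConstrIdeal S) : Continuous fun χ : ConstrIdeal S → Bool => χ X && χ Y :=
    (continuous_of_discreteTopology (f := fun b : Bool × Bool => b.1 && b.2)).comp₂
      (continuous_apply X) (continuous_apply Y)
  have hclosed : IsClosed {χ : ConstrIdeal S → Bool |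
      (∀ X Y, χ (X.inter Y) = (χ X && χ Y)) ∧ ∃ X, χ X = true} := by
    rw [heq]
    exact (isClosed_iInter fun X => isClosed_iInter fun Y =>
      isClosed_eq (continuous_apply _) (hand X Y)).inter
        (isClosed_eq (continuous_apply _) continuous_const)
  exact isCompact_iff_compactSpace.1 hclosed.isCompact

/-- The basic open set of the semi-characters `χ` with `χ(p_X) = 1` and `χ(p_Y) = 0` for
`Y ∈ F`. -/
def cylinder (X : ConstrIdeal S) (F : Finset (ConstrIdeal S)) : Set (SemiChar S) :=
  {χ | χ.1 X = true ∧ ∀ Y ∈ F, χ.1 Y = false}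

theorem isClopen_cylinder (X : ConstrIdeal S) (F : Finset (ConstrIdeal S)) :
    IsClopen (cylinder X F) := by
  have heq : cylinder X F = {χ | χ.1 X = true} ∩ ⋂ Y ∈ F, {χ | χ.1 Y = false} := by
    ext χ
    simp only [cylinder, Set.mem_inter_iff, Set.mem_iInter, Set.mem_ofPred_eq]
  rw [heq]
  exact (isClopen_setOf_eq X true).inter
    (isClopen_biInter_finset fun Y _ => isClopen_setOf_eq Y false)

theorem point_mem_cylinder_iff {s : S} {X : ConstrIdeal S} {F : Finset (ConstrIdeal S)} :
    point s ∈ cylinder X F ↔ s ∈ X.1 \ ⋃ Y ∈ F, Y.1 := by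
  simp [cylinder, point]

theorem act_injective {g : InvHull S} {χ ψ : SemiChar S} (hχ : χ.1 g.dom = true)
    (hψ : ψ.1 g.dom = true) (h : act g χ hχ = act g ψ hψ) : χ = ψ := by
  refine Subtype.ext (funext fun X => ?_)
  rw [← χ.pre_inv_eq g hχ, ← ψ.pre_inv_eq g hψ]
  exact congrArg (fun η : SemiChar S => η.1 (g.inv.pre X)) h

end SemiChar

theorem IsConstructible.principal (s : S) : IsConstructible S (Set.range fun r => s * r) := by
  simpa using IsConstructible.step 1 s Set.univ .univ

namespace Paterson

theorem mk_mem_basicSet_iff {g k : InvHull S} {χ : SemiChar S} {hk : χ.1 k.dom = true}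
    {U : Set (SemiChar S)} :
    mk k χ hk ∈ basicSet g U ↔ χ ∈ U ∧ ∃ hg, mk k χ hk = mk g χ hg := by
  constructor
  · rintro ⟨ψ, hg, hψ, e⟩
    obtain rfl : χ = ψ := congrArg src e
    exact ⟨hψ, hg, e⟩
  · rintro ⟨hχ, hg, e⟩
    exact ⟨χ, hg, hχ, e⟩

theorem isOpen_basicSet {g : InvHull S} {U : Set (SemiChar S)} (hU : IsOpen U)
    (hUg : U ⊆ {χ | χ.1 g.dom = true}) : IsOpen (basicSet g U) :=
  TopologicalSpace.isOpen_generateFrom_of_mem ⟨g, U, hU, hUg, rfl⟩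

theorem continuous_src : Continuous (Grpd.src : Paterson S → SemiChar S) := by
  refine ⟨fun V hV => ?_⟩
  have hpre : (Grpd.src : Paterson S → SemiChar S) ⁻¹' V =
      ⋃ g : InvHull S, basicSet g (V ∩ {χ | χ.1 g.dom = true}) := by
    ext a
    obtain ⟨g, χ, h, rfl⟩ := a.exists_rep
    simp only [Set.mem_iUnion, mk_mem_basicSet_iff]
    exact ⟨fun hχ => ⟨g, ⟨hχ, h⟩, h, rfl⟩, fun ⟨_, hχ, _⟩ => hχ.1⟩
  rw [hpre]
  exact isOpen_iUnion fun g =>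
    isOpen_basicSet (hV.inter (SemiChar.isClopen_setOf_eq _ _).isOpen) Set.inter_subset_right

theorem continuous_mk (g : InvHull S) :
    Continuous fun χ : {χ : SemiChar S // χ.1 g.dom = true} => mk g χ.1 χ.2 := by
  refine continuous_generateFrom_iff.2 ?_
  rintro _ ⟨h, V, hV, hVh, rfl⟩
  refine isOpen_iff_mem_nhds.2 fun ⟨χ, hχ⟩ hmem => ?_
  obtain ⟨hχV, _, e⟩ := mk_mem_basicSet_iff.1 hmem
  obtain ⟨_, ⟨X, rfl, hX⟩, hgh⟩ := (mk_eq_iff _ _ _ _ _).1 e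
  have hnhds : Subtype.val ⁻¹' (V ∩ {ψ | ψ.1 X = true}) ∈
      nhds (⟨χ, hχ⟩ : {χ // χ.1 g.dom = true}) :=
    ((hV.inter (SemiChar.isClopen_setOf_eq X true).isOpen).preimage
      continuous_subtype_val).mem_nhds ⟨hχV, hX⟩
  filter_upwards [hnhds] with ψ hψ
  exact mk_mem_basicSet_iff.2
    ⟨hψ.1, hVh hψ.1, (mk_eq_iff _ _ _ _ _).2 ⟨_, ⟨X, rfl, hψ.2⟩, hgh⟩⟩

theorem mk_point_eq_mk_point {g h : InvHull S} {s : S}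
    (hg : (SemiChar.point s).1 g.dom = true) (hh : (SemiChar.point s).1 h.dom = true)
    (hgh : g.1 s = h.1 s) : mk g (SemiChar.point s) hg = mk h (SemiChar.point s) hh := by
  refine (mk_eq_iff _ _ _ _ _).2 ⟨_, ⟨⟨_, IsConstructible.principal s⟩, rfl,
    (SemiChar.point_eq_true _ _).2 ⟨1, mul_one s⟩⟩, ?_⟩
  rintro _ ⟨r, rfl⟩
  obtain ⟨t, ht⟩ := Option.isSome_iff_exists.1 ((SemiChar.point_eq_true _ _).1 hg)
  exact (g.2.map_mul s r t ht).trans (h.2.map_mul s r t (hgh ▸ ht)).symm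

end Paterson

namespace GroupoidP

/-- `{[g, χ] | χ ∈ U ∩ Ω(S)}`. -/
def basicSet (g : InvHull S) (U : Set (SemiChar S)) : Set (GroupoidP S) :=
  Subtype.val ⁻¹' Paterson.basicSet g U

theorem isBisection_basicSet (g : InvHull S) (U : Set (SemiChar S)) :
    Grpd.IsBisection (basicSet g U) where
  src_injOn := by
    rintro ⟨_, _⟩ ⟨χ, _, _, rfl⟩ ⟨_, _⟩ ⟨ψ, _, _, rfl⟩ e
    obtain rfl : χ = ψ := congrArg Subtype.val e
    rfl
  rng_injOn := by
    rintro ⟨_, _⟩ ⟨χ, hχ, _, rfl⟩ ⟨_, _⟩ ⟨ψ, hψ, _, rfl⟩ e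
    obtain rfl : χ = ψ := SemiChar.act_injective hχ hψ (congrArg Subtype.val e)
    rfl

theorem isCompact_basicSet {g : InvHull S} {U : Set (SemiChar S)} (hU : IsClosed U)
    (hUg : U ⊆ {χ | χ.1 g.dom = true}) : IsCompact (basicSet g U) := by
  have : CompactSpace ↥(U ∩ omegaSet S) :=
    isCompact_iff_compactSpace.1 (hU.inter isClosed_closure).isCompact
  let f : ↥(U ∩ omegaSet S) → GroupoidP S := fun χ => mk g χ.1 χ.2.2 (hUg χ.2.1)
  have hf : Continuous f := ((Paterson.continuous_mk g).comp
    (continuous_subtype_val.subtype_mk fun χ => hUg χ.2.1)).subtype_mk _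
  have hrange : basicSet g U = Set.range f := by
    ext a
    obtain ⟨k, χ, hχ, hk, rfl⟩ := a.exists_rep
    constructor
    · rintro hmem
      obtain ⟨hχU, _, e⟩ := Paterson.mk_mem_basicSet_iff.1 hmem
      exact ⟨⟨χ, hχU, hχ⟩, Subtype.ext e.symm⟩
    · rintro ⟨ψ, e⟩
      exact e ▸ ⟨ψ.1, hUg ψ.2.1, ψ.2.1, rfl⟩
  exact hrange ▸ isCompact_range hf

theorem isCompactOpenBisection_basicSet {g : InvHull S} {U : Set (SemiChar S)} (hU : IsClopen U)
    (hUg : U ⊆ {χ | χ.1 g.dom = true}) : Grpd.IsCompactOpenBisection (basicSet g U) where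
  toIsBisection := isBisection_basicSet g U
  isOpen := (Paterson.isOpen_basicSet hU.isOpen hUg).preimage continuous_subtype_val
  isCompact := isCompact_basicSet hU.isClosed hUg
  t2Space := T2Space.of_injective_continuous (f := fun a : basicSet g U => Grpd.src a.1.1)
    (fun a b e => Subtype.ext ((isBisection_basicSet g U).src_injOn a.2 b.2 (Subtype.ext e)))
    (Paterson.continuous_src.comp (continuous_subtype_val.comp continuous_subtype_val))

theorem isTopIso_toQ (H : ∀ a b : GroupoidP S, Rel a b → a = b) :
    Grpd.IsTopIso (toQ : GroupoidP S → GroupoidQ S) where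
  isHomeomorph := isHomeomorph_iff_isQuotientMap_injective.2
    ⟨isQuotientMap_quot_mk, fun a b hab => H a b ((GroupoidQ.toQ_eq_iff a b).1 hab)⟩
  src_map _ := rfl
  rng_map _ := rfl
  unit_map _ := rfl
  inv_map a := (GroupoidQ.inv_toQ a).symm
  mul_map a b h := (GroupoidQ.mul_toQ a b h).symm

/-! ### Faithfulness of `ρ_{χ_e}` -/

theorem exists_eq_point_of_mem_orbit {ω : omegaSet S}
    (hω : ω ∈ Grpd.orbit (GroupoidP S) (chiE S)) : ∃ s, ω.1 = SemiChar.point s := by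
  obtain ⟨a, ha, rfl⟩ := hω
  have hmem : (Grpd.rng a).1 ∈ Set.range (SemiChar.point (S := S)) :=
    orbit_point_one (S := S) ▸ ⟨a.1, congrArg Subtype.val ha, rfl⟩
  exact hmem.imp fun _ => Eq.symm

theorem mem_basicSet_iff_of_src_eq_point {g h : InvHull S} {U : Set (SemiChar S)} {s : S}
    (hUg : U ⊆ {χ | χ.1 g.dom = true}) (hUh : U ⊆ {χ | χ.1 h.dom = true})
    (hgh : SemiChar.point s ∈ U → g.1 s = h.1 s) {a : GroupoidP S}
    (ha : a.1.src = SemiChar.point s) : a ∈ basicSet g U ↔ a ∈ basicSet h U := by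
  obtain ⟨k, hk, ha⟩ := Paterson.exists_rep_of_src ha
  simp only [basicSet, Set.mem_preimage, ha, Paterson.mk_mem_basicSet_iff]
  refine and_congr_right fun hs => ?_
  have hmk := Paterson.mk_point_eq_mk_point (hUg hs) (hUh hs) (hgh hs)
  exact ⟨fun ⟨_, e⟩ => ⟨hUh hs, e.trans hmk⟩, fun ⟨_, e⟩ => ⟨hUg hs, e.trans hmk.symm⟩⟩

theorem eq_of_rel_of_injective_rho (hρ : Function.Injective (rho (GroupoidP S) (chiE S)))
    {a b : GroupoidP S} (hab : Rel a b) : a = b := by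
  obtain ⟨χ, hχ, g, h, hg, hh, rfl, rfl, _, ⟨X, F, rfl, hX, hF⟩, hgh⟩ := hab
  let D := X.inter (g.dom.inter h.dom)
  have hD (ψ : SemiChar S) :
      ψ.1 D = true ↔ ψ.1 X = true ∧ ψ.1 g.dom = true ∧ ψ.1 h.dom = true := by
    rw [ψ.inter_eq_true, ψ.inter_eq_true]
  let U := SemiChar.cylinder D F
  have hχU : χ ∈ U := ⟨(hD χ).2 ⟨hX, hg, hh⟩, hF⟩
  have hUg : U ⊆ {ψ | ψ.1 g.dom = true} := fun ψ hψ => ((hD ψ).1 hψ.1).2.1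
  have hUh : U ⊆ {ψ | ψ.1 h.dom = true} := fun ψ hψ => ((hD ψ).1 hψ.1).2.2
  have hpoint (s : S) (hs : SemiChar.point s ∈ U) : g.1 s = h.1 s :=
    hgh (SemiChar.point_mem_cylinder_iff.1 ⟨((hD _).1 hs.1).1, hs.2⟩)
  have hU : IsClopen U := SemiChar.isClopen_cylinder D F
  have hBC : basicSet g U = basicSet h U :=
    (isCompactOpenBisection_basicSet hU hUg).eq_of_injective_rho
      (isCompactOpenBisection_basicSet hU hUh) hρ fun _ hk =>
        (exists_eq_point_of_mem_orbit hk).elim fun s =>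
          mem_basicSet_iff_of_src_eq_point hUg hUh (hpoint s)
  have hmem : mk g χ hχ hg ∈ basicSet h U := hBC ▸ ⟨χ, hg, hχU, rfl⟩
  obtain ⟨_, _, e⟩ := Paterson.mk_mem_basicSet_iff.1 hmem
  exact Subtype.ext e

end GroupoidP

theorem injective_rho_of_injective_rhoChiE (h : Function.Injective (rhoChiE S)) :
    Function.Injective (rho (GroupoidP S) (chiE S)) :=
  Function.Injective.of_comp (f := (ellTwoCongr (fiberEquiv S)).conjStarAlgEquiv) h

theorem RhoDefinesIso.injective_rhoChiE (H : RhoDefinesIso S) :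
    Function.Injective (rhoChiE S) := by
  obtain ⟨φ, hφ⟩ := H
  rw [← funext hφ]
  exact Subtype.val_injective.comp φ.injective

/-! ### Covers of fixed point sets -/

variable (S) in
/-- The case `n = 1` of strong C*-regularity: if `h` fixes `X \ (X₁ ∪ ⋯ ∪ X_m)` pointwise, then
this set is covered by finitely many constructible ideals `Y` with `h p_Y = p_Y`. -/
def FixedSetsCovered : Prop :=
  ∀ (h : InvHull S) (X : ConstrIdeal S) (F : Finset (ConstrIdeal S)),
    (∀ s ∈ X.1 \ ⋃ Y ∈ F, Y.1, h.1 s = some s) →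
    ∃ C : Finset (ConstrIdeal S),
      X.1 \ ⋃ Y ∈ F, Y.1 ⊆ ⋃ Y ∈ C, Y.1 ∧ ∀ Y ∈ C, ∀ s ∈ Y.1, h.1 s = some s

theorem StronglyCStarRegular.fixedSetsCovered (H : StronglyCStarRegular S) :
    FixedSetsCovered S := by
  classical
  intro h X F hfix
  rcases (X.1 \ ⋃ Y ∈ F, Y.1).eq_empty_or_nonempty with hempty | hne
  · exact ⟨∅, by simp [hempty]⟩
  let Xs : Fin F.card → ConstrIdeal S := fun i => F.equivFin.symm i
  have hXs : ⋃ i, (Xs i).1 = ⋃ Y ∈ F, Y.1 := by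
    rw [F.equivFin.symm.surjective.iUnion_comp fun Y : F => Y.1.1, Set.iUnion_subtype]
  rw [← hXs] at hfix hne ⊢
  obtain ⟨_, Y, _, hcover, hY⟩ := H 1 F.card (fun _ => h) X Xs hne
    fun s hs => Set.mem_iUnion.2 ⟨0, hfix s hs⟩
  exact ⟨Finset.univ.image Y, by simpa using hcover, by simpa using hY⟩

theorem exists_mem_of_mem_omegaSet {χ : SemiChar S} (hχ : χ ∈ omegaSet S) {X : ConstrIdeal S}
    {F C : Finset (ConstrIdeal S)} (hXF : χ ∈ SemiChar.cylinder X F)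
    (hcover : X.1 \ ⋃ Y ∈ F, Y.1 ⊆ ⋃ Y ∈ C, Y.1) : ∃ Y ∈ C, χ.1 Y = true := by
  classical
  obtain ⟨s, hs⟩ := (mem_omegaSet_iff χ).1 hχ (insert X (F ∪ C))
  have hsF : ∀ Y ∈ F, s ∉ Y.1 := fun Y hY hsY =>
    Bool.false_ne_true ((hXF.2 Y hY).symm.trans ((hs Y (by simp [hY])).2 hsY))
  have hsX : s ∈ X.1 \ ⋃ Y ∈ F, Y.1 := ⟨(hs X (by simp)).1 hXF.1, by simpa using hsF⟩
  obtain ⟨Y, hY, hsY⟩ := Set.mem_iUnion₂.1 (hcover hsX)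
  exact ⟨Y, hY, (hs Y (by simp [hY])).2 hsY⟩

theorem InvHull.inv_mul_apply_eq_some_self_iff {g h : InvHull S} {s : S} :
    (g.inv.mul h).1 s = some s ↔ s ∈ g.domSet ∧ g.1 s = h.1 s := by
  change (h.1 s).bind g.1.symm = some s ↔ (g.1 s).isSome ∧ g.1 s = h.1 s
  simp only [Option.bind_eq_some_iff, PEquiv.eq_some_iff, Option.isSome_iff_exists]
  constructor
  · rintro ⟨t, ht, hgt⟩
    exact ⟨⟨t, hgt⟩, hgt.trans ht.symm⟩
  · rintro ⟨⟨t, hgt⟩, hgh⟩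
    exact ⟨t, hgh ▸ hgt, hgt⟩

theorem FixedSetsCovered.eq_of_rel (H : FixedSetsCovered S) {a b : GroupoidP S}
    (hab : GroupoidP.Rel a b) : a = b := by
  obtain ⟨χ, hχ, g, h, hg, hh, rfl, rfl, _, ⟨X, F, rfl, hX, hF⟩, hgh⟩ := hab
  have hfix : ∀ s ∈ (X.inter g.dom).1 \ ⋃ Y ∈ F, Y.1, (g.inv.mul h).1 s = some s :=
    fun s hs => InvHull.inv_mul_apply_eq_some_self_iff.2 ⟨hs.1.2, hgh ⟨hs.1.1, hs.2⟩⟩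
  obtain ⟨C, hcover, hC⟩ := H _ _ _ hfix
  obtain ⟨Y, hYC, hY⟩ :=
    exists_mem_of_mem_omegaSet hχ ⟨(χ.inter_eq_true _ _).2 ⟨hX, hg⟩, hF⟩ hcover
  exact Subtype.ext ((Paterson.mk_eq_iff _ _ _ _ _).2 ⟨Y.1, ⟨Y, rfl, hY⟩, fun s hs =>
    (InvHull.inv_mul_apply_eq_some_self_iff.1 (hC Y hYC s hs)).2⟩)

end paterson

theorem proposition2p11_general (S : Type u) [LeftCancelMonoid S] :
    (Function.Injective (rhoChiE S) →
        Grpd.IsTopIso (GroupoidP.toQ : GroupoidP S → GroupoidQ S)) ∧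
      (FixedSetsCovered S → Grpd.IsTopIso (GroupoidP.toQ : GroupoidP S → GroupoidQ S)) :=
  ⟨fun H => GroupoidP.isTopIso_toQ fun _ _ =>
      GroupoidP.eq_of_rel_of_injective_rho (injective_rho_of_injective_rhoChiE H),
    fun H => GroupoidP.isTopIso_toQ fun _ _ => H.eq_of_rel⟩

theorem proposition2p11 (S : Type u) [LeftCancelMonoid S] :
    (RhoDefinesIso S → Grpd.IsTopIso (GroupoidP.toQ : GroupoidP S → GroupoidQ S)) ∧
      (StronglyCStarRegular S →
        Grpd.IsTopIso (GroupoidP.toQ : GroupoidP S → GroupoidQ S)) :=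
  (proposition2p11_general S).imp (fun H h => H h.injective_rhoChiE)
    fun H h => H h.fixedSetsCovered
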